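/- Let $v>0$ and $\lambda_0>0$, let $N$ be a homogeneous Poisson process with rate $\lambda_0$, let $V(0)$ be independent of $N$ with $P(V(0)=v)=P(V(0)=-v)=1/2$, and let $X(t)=V(0)\int_0^t(-1)^{N(s)}\,ds$ be the telegraph process. For each $n$, $X$ is observed at the times $i\Delta_n$, $i=0,\dots,n$, with $\Delta_n>0$, and $\eta_i=X(i\Delta_n)-X((i-1)\Delta_n)$. Assume that $\Delta_n\to0$ and $n\Delta_n\to\infty$ as $n\to\infty$. Then: (a) With probability tending to one, the moment equation $$\frac1n\sum_{i=1}^n\eta_i^2=\frac{v^2}{\lambda}\Big(\Delta_n-\frac{1-e^{-2\lambda\Delta_n}}{2\lambda}\Big)$$ has exactly one solution $\lambda>0$. (b) Let $\check\lambda_n$ be any random variables such that, almost surely, $\check\lambda_n$ is a positive solution of this equation whenever it has one (with arbitrary values otherwise). Then $\check\lambda_n\to\lambda_0$ in probability and $$\sqrt{n\Delta_n}\,(\check\lambda_n-\lambda_0)\overset{d}{\longrightarrow}N\Big(0,\tfrac65\lambda_0\Big).$$ (c) Call estimators $\lambda_n$ asymptotically efficient at $\lambda_0$ if $\sqrt{n\Delta_n}(\lambda_n-\lambda_0)\to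 N(0,I(\lambda_0)^{-1})$ in distribution, where $I(\lambda)$ is the Fisher information of the Poisson process with rate $\lambda$ observed continuously over a unit time interval. Then $I(\lambda_0)^{-1}=\lambda_0<\frac65\lambda_0$, the estimators $N(n\Delta_n)/(n\Delta_n)$ based on continuous observation are asymptotically efficient at $\lambda_0$, and $\check\lambda_n$ is not. -/

import Mathlib

open MeasureTheory ProbabilityTheory Filter Set Topology
open scoped NNReal ENNReal

noncomputable section

/-- `N` is a homogeneous Poisson process with rate `lam` under `P`: it starts from `0`, has
independent increments, the number of events in `(s, t]` is Poisson distributed with mean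
`lam * (t - s)`, and its paths are nondecreasing and right-continuous. -/
structure IsPoissonProcess {Ω : Type*} [MeasurableSpace Ω] (N : ℝ≥0 → Ω → ℕ) (lam : ℝ≥0)
    (P : Measure Ω) : Prop where
  measurable : ∀ t, Measurable (N t)
  zero : ∀ᵐ ω ∂P, N 0 ω = 0
  indepIncrements : HasIndepIncrements N P
  law_increment : ∀ s t, s ≤ t →
    HasLaw (fun ω => N t ω - N s ω) (poissonMeasure (lam * (t - s))) P
  path : ∀ᵐ ω ∂P, Monotone (fun t => N t ω) ∧
    ∀ t, ContinuousWithinAt (fun s => N s ω) (Ici t) t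

/-- The telegraph process with initial velocity `V₀` driven by `N`:
`X(t) = V₀ ∫₀ᵗ (-1)^{N(s)} ds`. -/
def telegraph {Ω : Type*} (V₀ : Ω → ℝ) (N : ℝ≥0 → Ω → ℕ) (t : ℝ) (ω : Ω) : ℝ :=
  V₀ ω * ∫ s in (0 : ℝ)..t, (-1 : ℝ) ^ N s.toNNReal ω

/-- `V₀` and `N` are the data of a telegraph process with speed `v` and switching rate `lam`:
`N` is a Poisson process with rate `lam`, the initial velocity `V₀` is `v` or `-v` with
probability `1/2` each, and it is independent of `N`. -/
structure IsTelegraphModel {Ω : Type*} [MeasurableSpace Ω] (V₀ : Ω → ℝ) (N : ℝ≥0 → Ω → ℕ)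
    (v : ℝ) (lam : ℝ≥0) (P : Measure Ω) : Prop where
  poisson : IsPoissonProcess N lam P
  law_velocity : HasLaw V₀
    ((1 / 2 : ℝ≥0∞) • Measure.dirac v + (1 / 2 : ℝ≥0∞) • Measure.dirac (-v)) P
  indep : IndepFun V₀ (fun ω t => N t ω) P

/-- The mean of the squared increments over the `n` cells of the grid `0, Δ, …, nΔ`,
`(1/n) ∑ᵢ (X(iΔ) - X((i-1)Δ))²`. -/
def meanSqIncrement (X : ℝ → ℝ) (Δ : ℝ) (n : ℕ) : ℝ :=
  (1 / n) * ∑ i ∈ Finset.range n, (X ((i + 1 : ℕ) * Δ) - X (i * Δ)) ^ 2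

/-- `(v²/l) (Δ - (1 - e^{-2 l Δ}) / (2 l))`. -/
def secondMoment (v Δ l : ℝ) : ℝ :=
  v ^ 2 / l * (Δ - (1 - Real.exp (-2 * l * Δ)) / (2 * l))

/-- `l` is a solution in `(0, ∞)` of the moment equation for the observed path `X`. -/
def SolvesMomentEquation (v Δ : ℝ) (n : ℕ) (X : ℝ → ℝ) (l : ℝ) : Prop :=
  0 < l ∧ meanSqIncrement X Δ n = secondMoment v Δ l

/-- `est n` is a random variable that, almost surely, solves the moment equation of the
`n`-th sample whenever this equation has a solution (no value is prescribed otherwise). -/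
structure IsMomentEstimator {Ω : Type*} [MeasurableSpace Ω] (P : Measure Ω) (v : ℝ)
    (Δ : ℕ → ℝ) (X : ℝ → Ω → ℝ) (est : ℕ → Ω → ℝ) : Prop where
  aemeasurable : ∀ n, AEMeasurable (est n) P
  solves : ∀ n, ∀ᵐ ω ∂P, (∃ l, SolvesMomentEquation v (Δ n) n (fun t => X t ω) l) →
    SolvesMomentEquation v (Δ n) n (fun t => X t ω) (est n ω)

/-- The Fisher information at `l` contained in a unit time interval of a continuously observed
Poisson process with rate `l`, computed from the number of events in that interval, which is a
sufficient statistic with the Poisson law `e^{-l} l^k / k!`: the mean squared score. -/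
def poissonFisherInformation (l : ℝ≥0) : ℝ :=
  ∫ k : ℕ, (deriv (fun x : ℝ => Real.log (Real.exp (-x) * x ^ k / (k.factorial : ℝ))) (l : ℝ)) ^ 2
    ∂(poissonMeasure l)

/-- `√(T n) (est n - lam)` converges in distribution to `N(0, σ2)`. -/
def IsAsymptoticallyNormal {Ω : Type*} [MeasurableSpace Ω] (P : Measure Ω)
    [IsProbabilityMeasure P] (T : ℕ → ℝ) (est : ℕ → Ω → ℝ) (lam : ℝ) (σ2 : ℝ≥0) : Prop :=
  TendstoInDistribution (fun n ω => √(T n) * (est n ω - lam)) atTop (id : ℝ → ℝ)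
    (fun _ => P) (gaussianReal 0 σ2)

/-- Asymptotic efficiency at `lam` of estimators based on the time horizons `T n`: asymptotic
normality with the minimal variance, the inverse of the Fisher information per unit time of the
continuously observed process. -/
def IsAsymptoticallyEfficient {Ω : Type*} [MeasurableSpace Ω] (P : Measure Ω)
    [IsProbabilityMeasure P] (T : ℕ → ℝ) (est : ℕ → Ω → ℝ) (lam : ℝ≥0) : Prop :=
  IsAsymptoticallyNormal P T est lam (poissonFisherInformation lam)⁻¹.toNNReal

end

/-! Squaring an increment removes the random velocity sign and also the parity of `N` at the left
end of the cell. What remains, `v ^ 2 * cellSq`, depends only on the Poisson increments inside the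
cell, so the squared increments are i.i.d. (up to a null set), bounded by `v ^ 2 * Δ ^ 2`. After
division by `v ^ 2 * Δ ^ 2` the moment equation reads `secondMomentRatio (l * Δ) = S`, with `S` the
normalized empirical mean.

Write `x = λΔ`. The ratio is `1 - 2x/3 + O(x ^ 2)`, and `cellSq` has second moment `Δ ^ 4 * (1 -
4x/5 + O(x ^ 2))`, so its variance is `(8/15) λ Δ ^ 5` to leading order. Heuristically, a cell
contains one switch with probability about `x`, at a uniform place `U`, and `1 - (1 - 2U) ^ 2` has
first and second moments `2/3` and `8/15`. Inverting the slope `-2/3` turns the fluctuation of `S`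
into an error of the estimator with normalized variance `(3/2) ^ 2 * (8/15) λ = (6/5) λ`.

The sum `normalizedError` of the normalized cells obeys a central limit theorem for rows of i.i.d.
variables (`tendstoInDistribution_sum_iid_rows`), because each term is at most `(3/2) / √(nΔ)`. The
variance comes from `abs_fourthMoment_sub_le`. By Chebyshev, `normalizedError` is small against
`√(nΔ)` with probability tending to one; on that event `moment_solution_bound` gives a unique root,
differing from its linearization by a relative error `O(Δ)`. This yields existence, consistency and
the normal limit.

The Fisher information is `1/λ`, and `N(T)/T` attains the variance `λ` by the normal approximation
of Poisson laws. Uniqueness of weak limits then excludes efficiency of the moment estimator. -/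

/-! ### Characteristic functions and normal limits -/

theorem norm_cexp_sub_quadratic_le {z : ℂ} (hz : ‖z‖ ≤ 1) :
    ‖Complex.exp z - 1 - z - z ^ 2 / 2‖ ≤ ‖z‖ ^ 3 := by
  have h := Complex.exp_bound hz (n := 3) (by norm_num)
  simp only [Finset.sum_range_succ, Finset.sum_range_zero, Nat.factorial] at h
  have h3 : (0 : ℝ) ≤ ‖z‖ ^ 3 := by positivity
  refine (le_of_eq ?_).trans (h.trans ?_)
  · congr 1; push_cast; ring
  · norm_num; nlinarith

section RowCLT

variable {Ω : Type*} [MeasurableSpace Ω] {P : Measure Ω} [IsProbabilityMeasure P]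

/-- Second order expansion of the characteristic function of a bounded centred variable. -/
theorem norm_charFun_sub_quadratic_le {X : Ω → ℝ} (hX : AEMeasurable X P) {b : ℝ}
    (hb : ∀ᵐ ω ∂P, |X ω| ≤ b) (h0 : ∫ ω, X ω ∂P = 0) {t : ℝ} (ht : |t| * b ≤ 1) :
    ‖charFun (P.map X) t - 1 + ((t ^ 2 * ∫ ω, X ω ^ 2 ∂P : ℝ) : ℂ) / 2‖
      ≤ |t| ^ 3 * b * ∫ ω, X ω ^ 2 ∂P := by
  have hXm := hX.aestronglyMeasurable
  have hint : Integrable X P := Integrable.of_bound hXm b (by simpa using hb)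
  have hint2 : Integrable (fun ω => X ω ^ 2) P := by
    refine Integrable.of_bound (hXm.pow 2) (b ^ 2) ?_
    filter_upwards [hb] with ω hω
    rw [Real.norm_eq_abs, abs_pow]
    gcongr
  have hexp : Integrable (fun ω => Complex.exp (t * X ω * Complex.I)) P := by
    refine Integrable.of_bound (by fun_prop) 1 (Eventually.of_forall fun ω => ?_)
    rw [← Complex.ofReal_mul, Complex.norm_exp_ofReal_mul_I]
  have hintC : Integrable (fun ω => (t * X ω * Complex.I : ℂ)) P :=
    (hint.ofReal.const_mul _).mul_const _
  have hint2C : Integrable (fun ω => ((t * X ω * Complex.I) ^ 2 / 2 : ℂ)) P := by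
    have : Integrable (fun ω => ((-(t ^ 2) / 2 * X ω ^ 2 : ℝ) : ℂ)) P :=
      (hint2.const_mul (-(t ^ 2) / 2)).ofReal
    refine this.congr (Eventually.of_forall fun ω => ?_)
    simp only [mul_pow, Complex.I_sq]
    push_cast; ring
  have hsq : ∫ ω, ((t * X ω * Complex.I) ^ 2 / 2 : ℂ) ∂P
      = -(((t ^ 2 * ∫ ω, X ω ^ 2 ∂P : ℝ) : ℂ) / 2) := by
    rw [← integral_const_mul, ← integral_complex_ofReal, ← integral_div, ← integral_neg]
    refine integral_congr_ae (Eventually.of_forall fun ω => ?_)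
    simp only [mul_pow, Complex.I_sq]
    push_cast; ring
  have hlin : ∫ ω, (t * X ω * Complex.I : ℂ) ∂P = 0 := by
    rw [integral_mul_const, integral_const_mul, integral_complex_ofReal, h0]
    simp
  have hmain : charFun (P.map X) t - 1 + ((t ^ 2 * ∫ ω, X ω ^ 2 ∂P : ℝ) : ℂ) / 2
      = ∫ ω, (Complex.exp (t * X ω * Complex.I) - 1 - (t * X ω * Complex.I)
          - (t * X ω * Complex.I) ^ 2 / 2 : ℂ) ∂P := by
    have h1 : Integrable (fun ω => Complex.exp (t * X ω * Complex.I) - 1) P :=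
      hexp.sub (integrable_const _)
    have h2 : Integrable
        (fun ω => Complex.exp (t * X ω * Complex.I) - 1 - t * X ω * Complex.I) P := h1.sub hintC
    rw [integral_sub h2 hint2C, integral_sub h1 hintC,
      integral_sub hexp (integrable_const _), hsq, hlin, charFun_apply_real,
      integral_map hX (by fun_prop)]
    simp
  rw [hmain]
  refine (norm_integral_le_integral_norm _).trans ?_
  rw [← integral_const_mul]
  refine integral_mono_ae ?_ (hint2.const_mul _) ?_
  · exact (((hexp.sub (integrable_const _)).sub hintC).sub hint2C).norm
  · filter_upwards [hb] with ω hω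
    have hz : ‖(t * X ω * Complex.I : ℂ)‖ = |t| * |X ω| := by simp
    refine (norm_cexp_sub_quadratic_le ?_).trans ?_
    · rw [hz]
      exact (mul_le_mul_of_nonneg_left hω (abs_nonneg _)).trans ht
    · rw [hz, mul_pow]
      have : |X ω| ^ 3 = |X ω| * X ω ^ 2 := by rw [← sq_abs]; ring
      rw [this, mul_assoc]
      gcongr

theorem charFun_id_gaussianReal (s : ℝ≥0) (t : ℝ) :
    charFun ((gaussianReal 0 s).map id) t = Complex.exp (-((s * t ^ 2 : ℝ) : ℂ) / 2) := by
  rw [Measure.map_id, charFun_gaussianReal]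
  congr 1
  push_cast; ring

theorem tendstoInDistribution_gaussianReal_of_charFun {X : ℕ → Ω → ℝ}
    (hX : ∀ n, AEMeasurable (X n) P) (s : ℝ≥0)
    (h : ∀ t, Tendsto (fun n => charFun (P.map (X n)) t) atTop
      (𝓝 (Complex.exp (-((s * t ^ 2 : ℝ) : ℂ) / 2)))) :
    TendstoInDistribution X atTop (id : ℝ → ℝ) (fun _ => P) (gaussianReal 0 s) where
  forall_aemeasurable := hX
  tendsto := by
    refine ProbabilityMeasure.tendsto_iff_tendsto_charFun.2 fun t => ?_
    simpa only [ProbabilityMeasure.coe_mk, charFun_id_gaussianReal] using h t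

/-- Central limit theorem for triangular arrays whose rows are i.i.d., centred and uniformly
bounded by a null sequence. -/
theorem tendstoInDistribution_sum_iid_rows {W : ℕ → ℕ → Ω → ℝ}
    (hindep : ∀ n, iIndepFun (fun i : Fin n => W n i) P)
    (hident : ∀ n i, IdentDistrib (W n i) (W n 0) P P)
    (h0 : ∀ n, ∫ ω, W n 0 ω ∂P = 0) {b : ℕ → ℝ} (hb : ∀ n, ∀ᵐ ω ∂P, |W n 0 ω| ≤ b n)
    (hb0 : Tendsto b atTop (𝓝 0)) {s : ℝ≥0}
    (hvar : Tendsto (fun n : ℕ => n * ∫ ω, W n 0 ω ^ 2 ∂P) atTop (𝓝 s)) :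
    TendstoInDistribution (fun n ω => ∑ i : Fin n, W n i ω) atTop (id : ℝ → ℝ) (fun _ => P)
      (gaussianReal 0 s) := by
  have hm : ∀ n i, AEMeasurable (W n i) P := fun n i => (hident n i).aemeasurable_fst
  refine tendstoInDistribution_gaussianReal_of_charFun
    (fun n => Finset.aemeasurable_fun_sum (Finset.univ : Finset (Fin n)) fun i _ => hm n i) s fun t => ?_
  have hchar : ∀ n, charFun (P.map fun ω => ∑ i : Fin n, W n i ω) t
      = (1 + (charFun (P.map (W n 0)) t - 1)) ^ n := by
    intro n
    rw [iIndepFun.charFun_map_fun_sum_eq_prod (X := fun i : Fin n => W n i) (fun i => hm n i)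
      (hindep n)]
    simp [fun i => (hident n i).map_eq]
  simp_rw [hchar]
  -- It remains to find the limit of `n * (φ - 1)`, with `φ` the characteristic function of one
  -- summand: the quadratic term gives the Gaussian exponent, and the remainder is at most `|t| ^ 3
  -- * b n` times the convergent row variance.
  apply Complex.tendsto_one_add_pow_exp_of_tendsto
  have hvarC : Tendsto (fun n : ℕ => -((t ^ 2 * (n * ∫ ω, W n 0 ω ^ 2 ∂P) : ℝ) : ℂ) / 2) atTop
      (𝓝 (-((s * t ^ 2 : ℝ) : ℂ) / 2)) := by
    rw [mul_comm (s : ℝ)]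
    exact (((Complex.continuous_ofReal.tendsto _).comp (hvar.const_mul (t ^ 2))).neg).div_const 2
  have herr : Tendsto (fun n : ℕ => (n : ℂ) * (charFun (P.map (W n 0)) t - 1
      + ((t ^ 2 * ∫ ω, W n 0 ω ^ 2 ∂P : ℝ) : ℂ) / 2)) atTop (𝓝 0) := by
    have hlim : Tendsto (fun n : ℕ => |t| ^ 3 * b n * (n * ∫ ω, W n 0 ω ^ 2 ∂P)) atTop (𝓝 0) := by
      simpa using (hb0.const_mul (|t| ^ 3)).mul hvar
    refine squeeze_zero_norm' ?_ hlim
    have : ∀ᶠ n in atTop, |t| * b n ≤ 1 := by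
      have := (hb0.const_mul |t|)
      rw [mul_zero] at this
      exact this.eventually_le_const one_pos
    filter_upwards [this] with n hn
    rw [norm_mul, Complex.norm_natCast]
    have := norm_charFun_sub_quadratic_le (hm n 0) (hb n) (h0 n) hn
    calc (n : ℝ) * _ ≤ n * _ := mul_le_mul_of_nonneg_left this (by positivity)
      _ = _ := by ring
  refine (herr.add hvarC).congr' (Eventually.of_forall fun n => ?_) |>.trans (by simp)
  push_cast; ring

end RowCLT

/-- Normal approximation of the Poisson distribution. -/
theorem tendstoInDistribution_poisson {Ω : Type*} [MeasurableSpace Ω] {P : Measure Ω}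
    [IsProbabilityMeasure P] {K : ℕ → Ω → ℕ} {T : ℕ → ℝ} {lam : ℝ≥0}
    (hT0 : ∀ᶠ n in atTop, 0 < T n) (hT : Tendsto T atTop atTop)
    (hK : ∀ n, HasLaw (K n) (poissonMeasure (lam * (T n).toNNReal)) P) :
    TendstoInDistribution (fun n ω => √(T n) * ((K n ω : ℝ) / T n - lam)) atTop (id : ℝ → ℝ)
      (fun _ => P) (gaussianReal 0 lam) := by
  have hcast : ∀ n, AEMeasurable (fun ω => (K n ω : ℝ)) P := fun n =>
    (measurable_from_nat (f := fun k : ℕ => (k : ℝ))).comp_aemeasurable (hK n).aemeasurable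
  refine tendstoInDistribution_gaussianReal_of_charFun
    (fun n => (((hcast n).div_const _).sub_const _).const_mul _) lam fun t => ?_
  -- The Poisson characteristic function is an exponential, so centring just subtracts the linear
  -- term in the exponent. With `u = t / √T` and `T * u ^ 2 = t ^ 2`, the cubic remainder is at most
  -- `lam * t ^ 2 * |u|`.
  have hchar : ∀ᶠ n in atTop, charFun (P.map fun ω => √(T n) * ((K n ω : ℝ) / T n - lam)) t
      = Complex.exp (lam * T n * (Complex.exp ((t / √(T n) : ℝ) * Complex.I) - 1
          - (t / √(T n) : ℝ) * Complex.I)) := by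
    filter_upwards [hT0] with n hn
    have hfun : (fun ω => √(T n) * ((K n ω : ℝ) / T n - lam))
        = fun ω => (√(T n))⁻¹ * (K n ω : ℝ) + -(lam * √(T n)) := by
      ext ω
      have h1 : √(T n) * √(T n) = T n := Real.mul_self_sqrt hn.le
      have h2 : √(T n) ≠ 0 := (Real.sqrt_pos.2 hn).ne'
      field_simp
      rw [pow_two, h1]; ring
    have hlawR : P.map (fun ω => (K n ω : ℝ))
        = (poissonMeasure (lam * (T n).toNNReal)).map (Nat.cast : ℕ → ℝ) := by
      rw [← (hK n).map_eq, AEMeasurable.map_map_of_aemeasurable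
        (measurable_from_nat.aemeasurable) (hK n).aemeasurable]
      rfl
    have hcomp : P.map (fun ω => (√(T n))⁻¹ * (K n ω : ℝ) + -(lam * √(T n)))
        = (P.map (fun ω => (√(T n))⁻¹ * (K n ω : ℝ))).map (· + -(lam * √(T n))) := by
      rw [AEMeasurable.map_map_of_aemeasurable (by fun_prop) ((hcast n).const_mul _)]
      rfl
    rw [hfun, hcomp, charFun_map_add_const, charFun_map_mul_comp (hcast n), hlawR,
      charFun_map_cast_poissonMeasure, ← Complex.exp_add]
    congr 1
    have h1 : ((√(T n) : ℝ) : ℂ) * (√(T n) : ℝ) = (T n : ℂ) := by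
      rw [← Complex.ofReal_mul, Real.mul_self_sqrt hn.le]
    have h2 : ((√(T n) : ℝ) : ℂ) ≠ 0 := by exact_mod_cast (Real.sqrt_pos.2 hn).ne'
    have h3 : (((lam * (T n).toNNReal : ℝ≥0) : ℝ) : ℂ) = lam * T n := by
      rw [NNReal.coe_mul, Real.coe_toNNReal _ hn.le]; push_cast; rfl
    have h4 : (√(T n))⁻¹ * t = t / √(T n) := by ring
    rw [h3, h4, real_inner_eq_re_inner]
    simp only [RCLike.inner_apply, conj_trivial, RCLike.re_to_real]
    push_cast
    have h5 : (lam : ℂ) * T n * (t / (√(T n) : ℝ) * Complex.I)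
        = lam * (√(T n) : ℝ) * t * Complex.I := by
      rw [← h1]; field_simp
    linear_combination h5
  refine Tendsto.congr' (EventuallyEq.symm hchar) ?_
  refine (Complex.continuous_exp.tendsto _).comp ?_
  have hu : Tendsto (fun n => t / √(T n)) atTop (𝓝 0) :=
    (Real.tendsto_sqrt_atTop.comp hT).const_div_atTop t
  have hbound : Tendsto (fun n => lam * t ^ 2 * |t / √(T n)|) atTop (𝓝 0) := by
    simpa using hu.abs.const_mul (lam * t ^ 2 : ℝ)
  rw [← tendsto_sub_nhds_zero_iff]
  refine squeeze_zero_norm' ?_ hbound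
  have hsmall : ∀ᶠ n in atTop, |t / √(T n)| ≤ 1 := by
    simpa using hu.abs.eventually_le_const (by simp : |(0 : ℝ)| < 1)
  filter_upwards [hT0, hsmall] with n hn hs
  set u := t / √(T n) with hu_def
  have hTu : T n * u ^ 2 = t ^ 2 := by
    rw [hu_def, div_pow, Real.sq_sqrt hn.le]; field_simp
  have hz : ‖((u : ℂ) * Complex.I)‖ = |u| := by simp
  have h := norm_cexp_sub_quadratic_le (z := (u : ℂ) * Complex.I) (by rw [hz]; exact hs)
  have hTuC : (T n : ℂ) * (u : ℂ) ^ 2 = (t : ℂ) ^ 2 := by exact_mod_cast hTu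
  have heq : (lam : ℂ) * T n * (Complex.exp (u * Complex.I) - 1 - u * Complex.I)
      - -((lam * t ^ 2 : ℝ) : ℂ) / 2
      = lam * T n * (Complex.exp (u * Complex.I) - 1 - u * Complex.I
        - (u * Complex.I) ^ 2 / 2) := by
    rw [mul_pow, Complex.I_sq]
    push_cast
    linear_combination (-(lam : ℂ) / 2) * hTuC
  rw [heq, norm_mul]
  have hn2 : ‖(lam : ℂ) * T n‖ = lam * T n := by
    rw [norm_mul, Complex.norm_real, Complex.norm_real, Real.norm_of_nonneg hn.le,
      Real.norm_of_nonneg lam.coe_nonneg]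
  rw [hn2]
  calc (lam : ℝ) * T n * _ ≤ lam * T n * |u| ^ 3 := by
        rw [hz] at h
        exact mul_le_mul_of_nonneg_left h (by positivity)
    _ = lam * (T n * u ^ 2) * |u| := by rw [← sq_abs u]; ring
    _ = _ := by rw [hTu]

/-! ### Fisher information of the Poisson law -/

section Fisher

/-- The recursion `(k + 1) p (k + 1) = l p k` for the weights reduces each moment to lower ones,
giving mean `l` and second moment `l (l + 1)`. -/
theorem hasSum_poisson_sq_sub (l : ℝ) :
    HasSum (fun k : ℕ => Real.exp (-l) * l ^ k / (k.factorial : ℝ) * ((k : ℝ) - l) ^ 2) l := by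
  have he : HasSum (fun k : ℕ => Real.exp (-l) * l ^ k / (k.factorial : ℝ)) 1 := by
    have := (NormedSpace.expSeries_div_hasSum_exp l).mul_left (Real.exp (-l))
    rw [← Real.exp_eq_exp_ℝ, ← Real.exp_add] at this
    simpa [mul_div_assoc] using this
  set p : ℕ → ℝ := fun k => Real.exp (-l) * l ^ k / (k.factorial : ℝ) with hp
  have hrec : ∀ k, p (k + 1) * ((k + 1 : ℕ) : ℝ) = l * p k := by
    intro k
    simp only [hp, Nat.factorial_succ, pow_succ]
    have : ((k : ℝ) + 1) ≠ 0 := by positivity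
    have : ((k.factorial : ℝ)) ≠ 0 := by positivity
    push_cast
    field_simp
  have h1 : HasSum (fun k => p k * (k : ℝ)) l := by
    rw [← hasSum_nat_add_iff' 1]
    simpa [-Nat.cast_add, hrec] using he.mul_left l
  have h2 : HasSum (fun k => p k * (k : ℝ) ^ 2) (l * (l + 1)) := by
    rw [← hasSum_nat_add_iff' 1]
    have := (h1.add he).mul_left l
    simp only [Finset.range_one, Finset.sum_singleton, Nat.cast_zero, ne_eq, OfNat.ofNat_ne_zero,
      not_false_eq_true, zero_pow, mul_zero, sub_zero]
    refine this.congr_fun fun k => ?_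
    have := hrec k
    push_cast at this ⊢
    linear_combination ((k : ℝ) + 1) * this
  have := (h2.sub (h1.mul_left (2 * l))).add (he.mul_left (l ^ 2))
  have hval : l * (l + 1) - 2 * l * l + l ^ 2 * 1 = l := by ring
  rw [hval] at this
  exact this.congr_fun fun k => by simp only [hp]; ring

theorem deriv_log_poisson {l : ℝ} (hl : 0 < l) (k : ℕ) :
    deriv (fun x : ℝ => Real.log (Real.exp (-x) * x ^ k / (k.factorial : ℝ))) l
      = ((k : ℝ) - l) / l := by
  have hev : (fun x : ℝ => Real.log (Real.exp (-x) * x ^ k / (k.factorial : ℝ)))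
      =ᶠ[𝓝 l] fun x => -x + k * Real.log x - Real.log (k.factorial : ℝ) := by
    filter_upwards [lt_mem_nhds hl] with x hx
    rw [Real.log_div (by positivity) (by positivity), Real.log_mul (by positivity) (by positivity),
      Real.log_exp, Real.log_pow]
  rw [hev.deriv_eq]
  have : HasDerivAt (fun x : ℝ => -x + k * Real.log x - Real.log (k.factorial : ℝ))
      (-1 + k * l⁻¹) l :=
    ((hasDerivAt_id l).neg.add ((Real.hasDerivAt_log hl.ne').const_mul _)).sub_const _
  rw [this.deriv]
  field_simp
  ring

theorem poissonFisherInformation_eq {l : ℝ≥0} (hl : 0 < l) :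
    poissonFisherInformation l = (l : ℝ)⁻¹ := by
  have hl' : (0 : ℝ) < l := hl
  rw [poissonFisherInformation, integral_poissonMeasure]
  simp_rw [deriv_log_poisson hl']
  have := (hasSum_poisson_sq_sub (l : ℝ)).mul_left (((l : ℝ) ^ 2)⁻¹)
  have hv : ((l : ℝ) ^ 2)⁻¹ * l = (l : ℝ)⁻¹ := by field_simp
  rw [hv] at this
  refine Eq.trans (tsum_congr fun k => ?_) this.tsum_eq
  simp only [smul_eq_mul]
  field_simp

end Fisher

/-! ### The normalized moment equation -/

/-- The normalized second moment `E (X(t+Δ) - X(t))² / (vΔ)²` as a function of `x = λΔ`. -/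
noncomputable def secondMomentRatio (x : ℝ) : ℝ :=
  ∫ u in (0 : ℝ)..1, 2 * (1 - u) * Real.exp (-2 * x * u)

theorem intervalIntegrable_secondMomentRatio (x : ℝ) :
    IntervalIntegrable (fun u : ℝ => 2 * (1 - u) * Real.exp (-2 * x * u)) volume 0 1 :=
  (by fun_prop : Continuous fun u : ℝ => 2 * (1 - u) * Real.exp (-2 * x * u)).intervalIntegrable _ _

theorem secondMomentRatio_zero : secondMomentRatio 0 = 1 := by
  simp only [secondMomentRatio, mul_zero, zero_mul, Real.exp_zero, mul_one]
  rw [intervalIntegral.integral_const_mul, intervalIntegral.integral_sub (by simp) (by simp)]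
  simp; norm_num

/-- Links the integral form, which is regular at `0` and convenient for estimates, to the closed
form in the moment equation. -/
theorem secondMomentRatio_eq {x : ℝ} (hx : 0 < x) :
    secondMomentRatio x = 1 / x * (1 - (1 - Real.exp (-2 * x)) / (2 * x)) := by
  have hder : ∀ u ∈ uIcc (0 : ℝ) 1, HasDerivAt
      (fun u => ((1 - u) * (-1 / x) + 1 / (2 * x ^ 2)) * Real.exp (-2 * x * u))
      (2 * (1 - u) * Real.exp (-2 * x * u)) u := by
    intro u _
    have h1 : HasDerivAt (fun u : ℝ => (1 - u) * (-1 / x) + 1 / (2 * x ^ 2)) (-1 * (-1 / x)) u :=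
      (((hasDerivAt_id u).const_sub 1).mul_const _).add_const _
    have h2 : HasDerivAt (fun u : ℝ => Real.exp (-2 * x * u))
        (Real.exp (-2 * x * u) * (-2 * x * 1)) u := ((hasDerivAt_id u).const_mul _).exp
    refine (h1.mul h2).congr_deriv ?_
    field_simp
    ring
  rw [secondMomentRatio, intervalIntegral.integral_eq_sub_of_hasDerivAt hder
    (intervalIntegrable_secondMomentRatio x)]
  simp only [mul_zero, Real.exp_zero, mul_one, sub_self, zero_mul, sub_zero]
  field_simp
  ring

theorem integral_four_mul_sub_sq : ∫ u in (0 : ℝ)..1, 2 * (1 - u) * (2 * u) = 2 / 3 := by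
  have : (fun u : ℝ => 2 * (1 - u) * (2 * u)) = fun u => 4 * u - 4 * u ^ 2 := by ext u; ring
  rw [this, intervalIntegral.integral_sub
    ((by fun_prop : Continuous fun u : ℝ => 4 * u).intervalIntegrable _ _)
    ((by fun_prop : Continuous fun u : ℝ => 4 * u ^ 2).intervalIntegrable _ _)]
  rw [intervalIntegral.integral_const_mul, intervalIntegral.integral_const_mul, integral_id,
    integral_pow]
  norm_num

/-- Comparison of the integrands through `1 + z ≤ exp z`. The constant `2/3 = ∫ 4u(1 - u)` is minus
the slope at `0`; together with the lower bound in `le_secondMomentRatio_sub` this replaces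
differentiation under the integral. -/
theorem secondMomentRatio_sub_le {x y : ℝ} (hx : 0 ≤ x) (hxy : x ≤ y) :
    secondMomentRatio x - secondMomentRatio y ≤ 2 / 3 * (y - x) := by
  rw [secondMomentRatio, secondMomentRatio, ← intervalIntegral.integral_sub
    (intervalIntegrable_secondMomentRatio x) (intervalIntegrable_secondMomentRatio y),
    ← integral_four_mul_sub_sq, ← intervalIntegral.integral_mul_const]
  refine intervalIntegral.integral_mono_on zero_le_one
    (Continuous.intervalIntegrable (by fun_prop) _ _)
    (Continuous.intervalIntegrable (by fun_prop) _ _) fun u hu => ?_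
  have h1 : 0 ≤ 2 * (1 - u) := by linarith [hu.2]
  have h2 : Real.exp (-2 * y * u) = Real.exp (-2 * x * u) * Real.exp (-(2 * (y - x) * u)) := by
    rw [← Real.exp_add]; ring_nf
  have h3 : Real.exp (-2 * x * u) ≤ 1 := Real.exp_le_one_iff.2 (by nlinarith [hu.1])
  have h4 := Real.add_one_le_exp (-(2 * (y - x) * u))
  have h5 : 0 ≤ 2 * (y - x) * u := mul_nonneg (by linarith) hu.1
  have h6 : Real.exp (-2 * x * u) - Real.exp (-2 * y * u) ≤ 2 * u * (y - x) := by
    rw [h2]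
    nlinarith [Real.exp_pos (-2 * x * u)]
  nlinarith [mul_le_mul_of_nonneg_left h6 h1]

theorem le_secondMomentRatio_sub {x y : ℝ} (hx : 0 ≤ x) (hxy : x ≤ y) :
    2 / 3 * Real.exp (-2 * y) * (y - x) ≤ secondMomentRatio x - secondMomentRatio y := by
  rw [secondMomentRatio, secondMomentRatio, ← intervalIntegral.integral_sub
    (intervalIntegrable_secondMomentRatio x) (intervalIntegrable_secondMomentRatio y),
    ← integral_four_mul_sub_sq, mul_assoc, ← intervalIntegral.integral_mul_const]
  refine intervalIntegral.integral_mono_on zero_le_one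
    (Continuous.intervalIntegrable (by fun_prop) _ _)
    (Continuous.intervalIntegrable (by fun_prop) _ _) fun u hu => ?_
  have h1 : 0 ≤ 2 * (1 - u) := by linarith [hu.2]
  have h2 : Real.exp (-2 * x * u) = Real.exp (-2 * y * u) * Real.exp (2 * (y - x) * u) := by
    rw [← Real.exp_add]; ring_nf
  have h3 : Real.exp (-2 * y) ≤ Real.exp (-2 * y * u) := Real.exp_le_exp.2 (by nlinarith [hu.2])
  have h4 := Real.add_one_le_exp (2 * (y - x) * u)
  have h5 : 0 ≤ 2 * (y - x) * u := mul_nonneg (by linarith) hu.1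
  have h6 : 2 * u * (Real.exp (-2 * y) * (y - x))
      ≤ Real.exp (-2 * x * u) - Real.exp (-2 * y * u) := by
    rw [h2]
    nlinarith [Real.exp_pos (-2 * y * u), mul_le_mul_of_nonneg_right h3 h5,
      mul_le_mul_of_nonneg_left h4 (Real.exp_pos (-2 * y * u)).le]
  nlinarith [mul_le_mul_of_nonneg_left h6 h1]

theorem secondMomentRatio_strictAntiOn : StrictAntiOn secondMomentRatio (Ici 0) := by
  intro x hx y _ hxy
  have := le_secondMomentRatio_sub hx hxy.le
  have h2 : 0 < 2 / 3 * Real.exp (-2 * y) * (y - x) :=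
    mul_pos (by positivity) (sub_pos.2 hxy)
  linarith

theorem continuous_secondMomentRatio : Continuous secondMomentRatio :=
  intervalIntegral.continuous_parametric_intervalIntegral_of_continuous'
    (f := fun x u => 2 * (1 - u) * Real.exp (-2 * x * u)) (by fun_prop) 0 1

theorem secondMomentRatio_le_inv {x : ℝ} (hx : 0 < x) : secondMomentRatio x ≤ 1 / x := by
  rw [secondMomentRatio_eq hx]
  have h : Real.exp (-2 * x) ≤ 1 := Real.exp_le_one_iff.2 (by linarith)
  have : 0 ≤ (1 - Real.exp (-2 * x)) / (2 * x) := div_nonneg (by linarith) (by linarith)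
  exact mul_le_of_le_one_right (by positivity) (by linarith)

/-- The ratio decreases strictly from `1` at `0`, and is at most `1 / x`, so the value `S` has been
reached by `x = 1 / S`. -/
theorem existsUnique_secondMomentRatio_eq {S : ℝ} (h0 : 0 < S) (h1 : S < 1) :
    ∃! x, 0 < x ∧ secondMomentRatio x = S := by
  have hx1 : (0 : ℝ) ≤ 1 / S := by positivity
  have hle : secondMomentRatio (1 / S) ≤ S := by
    simpa using secondMomentRatio_le_inv (x := 1 / S) (by positivity)
  obtain ⟨x, hx, hxS⟩ := intermediate_value_Icc' hx1 continuous_secondMomentRatio.continuousOn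
    (show S ∈ Icc (secondMomentRatio (1 / S)) (secondMomentRatio 0) from
      ⟨hle, by rw [secondMomentRatio_zero]; exact h1.le⟩)
  have hxpos : 0 < x := by
    rcases hx.1.eq_or_lt with h | h
    · rw [← h, secondMomentRatio_zero] at hxS; linarith
    · exact h
  refine ⟨x, ⟨hxpos, hxS⟩, fun y ⟨hy, hyS⟩ => ?_⟩
  exact secondMomentRatio_strictAntiOn.injOn hy.le hxpos.le (hyS.trans hxS.symm)

theorem secondMoment_eq {v D l : ℝ} (hD : 0 < D) (hl : 0 < l) :
    secondMoment v D l = v ^ 2 * D ^ 2 * secondMomentRatio (l * D) := by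
  rw [secondMoment, secondMomentRatio_eq (mul_pos hl hD)]
  have : -2 * l * D = -2 * (l * D) := by ring
  rw [this]
  field_simp

theorem solvesMomentEquation_iff {v D : ℝ} (hv : 0 < v) (hD : 0 < D) {n : ℕ} {X : ℝ → ℝ} {S : ℝ}
    (hS : meanSqIncrement X D n = v ^ 2 * D ^ 2 * S) (l : ℝ) :
    SolvesMomentEquation v D n X l ↔ 0 < l * D ∧ secondMomentRatio (l * D) = S := by
  rw [SolvesMomentEquation, mul_pos_iff_of_pos_right hD]
  refine and_congr_right fun hl => ?_
  rw [hS, secondMoment_eq hD hl, mul_right_inj' (by positivity), eq_comm]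

theorem existsUnique_solvesMomentEquation {v D : ℝ} (hv : 0 < v) (hD : 0 < D) {n : ℕ}
    {X : ℝ → ℝ} {S : ℝ} (hS : meanSqIncrement X D n = v ^ 2 * D ^ 2 * S) (h0 : 0 < S)
    (h1 : S < 1) : ∃! l, SolvesMomentEquation v D n X l := by
  obtain ⟨x, hx, huniq⟩ := existsUnique_secondMomentRatio_eq h0 h1
  refine ⟨x / D, ?_, fun l hl => ?_⟩
  · refine (solvesMomentEquation_iff hv hD hS _).2 ?_
    rw [div_mul_cancel₀ _ hD.ne']
    exact hx
  · have hl := (solvesMomentEquation_iff hv hD hS _).1 hl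
    rw [eq_div_iff hD.ne', huniq _ hl]

/-! ### Moments of the integrated parity process -/

/-- A jointly measurable `±1`-valued process with right-continuous paths and the correlations of
the parity `(-1)^N` of a Poisson process with rate `lam`. -/
structure IsParityProcess {Ω : Type*} [MeasurableSpace Ω] (e : ℝ → Ω → ℝ) (lam : ℝ)
    (P : Measure Ω) : Prop where
  measurable : Measurable (Function.uncurry e)
  mul_self : ∀ s ω, e s ω * e s ω = 1
  rightCont : ∀ ω s, ContinuousWithinAt (fun r => e r ω) (Ici s) s
  integral_mul : ∀ b a u s, 0 ≤ b → b ≤ a → a ≤ u → u ≤ s →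
    ∫ ω, e b ω * e a ω * e u ω * e s ω ∂P
      = Real.exp (-2 * lam * (a - b)) * Real.exp (-2 * lam * (s - u))

namespace IsParityProcess

variable {Ω : Type*} [MeasurableSpace Ω] {P : Measure Ω}
  {e : ℝ → Ω → ℝ} {lam : ℝ}

theorem abs_eq (h : IsParityProcess e lam P) (s : ℝ) (ω : Ω) : |e s ω| = 1 := by
  rcases mul_self_eq_one_iff.1 (h.mul_self s ω) with h | h <;> simp [h]

theorem measurable_time (h : IsParityProcess e lam P) (ω : Ω) : Measurable fun s => e s ω :=
  h.measurable.comp measurable_prodMk_right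

theorem measurable_space (h : IsParityProcess e lam P) (s : ℝ) : Measurable (e s) :=
  h.measurable.comp measurable_prodMk_left

theorem intervalIntegrable (h : IsParityProcess e lam P) (ω : Ω) (a b : ℝ) :
    IntervalIntegrable (fun s => e s ω) volume a b :=
  (intervalIntegrable_const (c := (1 : ℝ))).mono_fun (h.measurable_time ω).aestronglyMeasurable
    (Eventually.of_forall fun s => by simp [h.abs_eq])

theorem continuous_integral (h : IsParityProcess e lam P) (ω : Ω) :
    Continuous fun t => ∫ s in (0 : ℝ)..t, e s ω :=
  intervalIntegral.continuous_primitive (fun a b => h.intervalIntegrable ω a b) 0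

theorem measurable_integral (h : IsParityProcess e lam P) :
    Measurable (Function.uncurry fun (t : ℝ) ω => ∫ s in (0 : ℝ)..t, e s ω) := by
  refine measurable_uncurry_of_continuous_of_measurable h.continuous_integral fun t => ?_
  have hm : StronglyMeasurable fun p : Ω × ℝ => e p.2 p.1 :=
    (h.measurable.comp measurable_swap).stronglyMeasurable
  simp only [intervalIntegral]
  exact (hm.integral_prod_right'.sub hm.integral_prod_right').measurable

theorem abs_integral_le (h : IsParityProcess e lam P) {t : ℝ} (ht : 0 ≤ t) (ω : Ω) :
    |∫ s in (0 : ℝ)..t, e s ω| ≤ t := by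
  have := intervalIntegral.norm_integral_le_of_norm_le_const (f := fun s => e s ω) (C := 1)
    (a := 0) (b := t) fun s _ => by simp [h.abs_eq]
  simpa [abs_of_nonneg ht] using this

theorem hasDerivWithinAt_integral (h : IsParityProcess e lam P) (ω : Ω) (t : ℝ) :
    HasDerivWithinAt (fun r => ∫ s in (0 : ℝ)..r, e s ω) (e t ω) (Ioi t) t := by
  refine HasDerivWithinAt.Ioi_of_Ici ?_
  exact intervalIntegral.integral_hasDerivWithinAt_right (h.intervalIntegrable ω 0 t)
    ((h.measurable_time ω).stronglyMeasurable.stronglyMeasurableAtFilter)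
    ((h.rightCont ω t).mono Ioi_subset_Ici_self)

/-- The paths are only right-continuous, so the fundamental theorem is applied with right
derivatives of the continuous primitive. -/
theorem integral_pow_succ (h : IsParityProcess e lam P) (ω : Ω) (k : ℕ) {t : ℝ} (ht : 0 ≤ t) :
    (∫ s in (0 : ℝ)..t, e s ω) ^ (k + 1)
      = ∫ s in (0 : ℝ)..t, (k + 1) * (∫ r in (0 : ℝ)..s, e r ω) ^ k * e s ω := by
  have hint := ((h.intervalIntegrable ω 0 t).continuousOn_mul
    (((h.continuous_integral ω).pow k).const_mul ((k : ℝ) + 1)).continuousOn)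
  have := intervalIntegral.integral_eq_sub_of_hasDeriv_right_of_le ht
    (f := fun t => (∫ s in (0 : ℝ)..t, e s ω) ^ (k + 1))
    (f' := fun s => (k + 1) * (∫ r in (0 : ℝ)..s, e r ω) ^ k * e s ω)
    ((h.continuous_integral ω).pow _).continuousOn
    (fun s _ => ((h.hasDerivWithinAt_integral ω s).pow (k + 1)).congr_deriv (by simp)) hint
  rw [this]
  simp

variable [IsProbabilityMeasure P]

theorem integral_intervalIntegral_swap {f : ℝ → Ω → ℝ} (hf : Measurable (Function.uncurry f))
    {t C : ℝ} (ht : 0 ≤ t) (hC : ∀ s ω, 0 ≤ s → s ≤ t → |f s ω| ≤ C) :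
    ∫ ω, (∫ s in (0 : ℝ)..t, f s ω) ∂P = ∫ s in (0 : ℝ)..t, ∫ ω, f s ω ∂P := by
  refine (intervalIntegral_integral_swap ?_).symm
  rw [uIoc_of_le ht]
  refine Integrable.of_bound hf.aestronglyMeasurable C ?_
  have hfst : ∀ᵐ p ∂((volume.restrict (Ioc 0 t)).prod P), p.1 ∈ Ioc (0 : ℝ) t :=
    Measure.quasiMeasurePreserving_fst.ae (ae_restrict_mem measurableSet_Ioc)
  filter_upwards [hfst] with p hp
  exact hC p.1 p.2 hp.1.le hp.2

/-- Integrating `Y_t ^ (k + 1) = (k + 1) ∫₀ᵗ Y_s ^ k e_s ds` against a bounded weight. -/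
theorem expectation_pow_succ_mul (h : IsParityProcess e lam P) (k : ℕ) {Z : Ω → ℝ}
    (hZ : Measurable Z) (hZ1 : ∀ ω, |Z ω| ≤ 1) {t : ℝ} (ht : 0 ≤ t) :
    ∫ ω, (∫ s in (0 : ℝ)..t, e s ω) ^ (k + 1) * Z ω ∂P
      = ∫ s in (0 : ℝ)..t, (k + 1) * ∫ ω, (∫ r in (0 : ℝ)..s, e r ω) ^ k * e s ω * Z ω ∂P := by
  have h1 : ∀ ω, (∫ s in (0 : ℝ)..t, e s ω) ^ (k + 1) * Z ω
      = ∫ s in (0 : ℝ)..t, (k + 1) * ((∫ r in (0 : ℝ)..s, e r ω) ^ k * e s ω * Z ω) := by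
    intro ω
    rw [h.integral_pow_succ ω k ht, ← intervalIntegral.integral_mul_const]
    simp only [mul_assoc]
  simp_rw [h1]
  rw [integral_intervalIntegral_swap (C := (k + 1) * t ^ k)]
  · simp_rw [integral_const_mul]
  · have := h.measurable_integral
    exact ((((this.pow_const k).mul h.measurable).mul (hZ.comp measurable_snd)).const_mul
      ((k : ℝ) + 1))
  · exact ht
  · intro s ω hs hst
    have hk : (0 : ℝ) ≤ (k : ℝ) + 1 := by positivity
    rw [abs_mul, abs_mul, abs_mul, h.abs_eq, abs_pow, abs_of_nonneg hk, mul_one]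
    have h2 := h.abs_integral_le hs ω
    have h3 : |∫ r in (0 : ℝ)..s, e r ω| ^ k ≤ t ^ k := by gcongr; exact h2.trans hst
    have h4 : |∫ r in (0 : ℝ)..s, e r ω| ^ k * |Z ω| ≤ t ^ k * 1 := by
      gcongr
      exact hZ1 ω
    rw [mul_one] at h4
    exact mul_le_mul_of_nonneg_left h4 hk

theorem integral_exp_sub (hlam : 0 < lam) (a : ℝ) :
    ∫ b in (0 : ℝ)..a, Real.exp (-2 * lam * (a - b)) = (1 - Real.exp (-2 * lam * a)) / (2 * lam) := by
  have hder : ∀ b ∈ uIcc (0 : ℝ) a, HasDerivAt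
      (fun b => Real.exp (-2 * lam * (a - b)) / (2 * lam)) (Real.exp (-2 * lam * (a - b))) b := by
    intro b _
    have := ((((hasDerivAt_id b).const_sub a).const_mul (-2 * lam)).exp).div_const (2 * lam)
    refine this.congr_deriv ?_
    simp only [id]
    field_simp
  rw [intervalIntegral.integral_eq_sub_of_hasDerivAt hder
    (Continuous.intervalIntegrable (by fun_prop) _ _)]
  simp [sub_div]

theorem integral_one_sub_exp (hlam : 0 < lam) {t : ℝ} (ht : 0 ≤ t) :
    ∫ a in (0 : ℝ)..t, 2 * ((1 - Real.exp (-2 * lam * a)) / (2 * lam))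
      = t ^ 2 * secondMomentRatio (lam * t) := by
  rcases ht.eq_or_lt with rfl | ht
  · simp
  have hder : ∀ b ∈ uIcc (0 : ℝ) t, HasDerivAt
      (fun b => b / lam + Real.exp (-2 * lam * b) / (2 * lam ^ 2))
      (2 * ((1 - Real.exp (-2 * lam * b)) / (2 * lam))) b := by
    intro b _
    have := ((hasDerivAt_id b).div_const lam).add
      ((((hasDerivAt_id b).const_mul (-2 * lam)).exp).div_const (2 * lam ^ 2))
    refine this.congr_deriv ?_
    simp only [id]
    field_simp
    ring
  rw [intervalIntegral.integral_eq_sub_of_hasDerivAt hder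
    (Continuous.intervalIntegrable (by fun_prop) _ _), secondMomentRatio_eq (by positivity)]
  have : -2 * (lam * t) = -2 * lam * t := by ring
  rw [this]
  simp only [mul_zero, Real.exp_zero, zero_div]
  field_simp
  ring

/-- Innermost layer of the iterated integral: after peeling off the last factor, only the four-time
correlation at `b ≤ a ≤ u ≤ s` is left. -/
theorem expectation_integral_mul (h : IsParityProcess e lam P) (hlam : 0 < lam) {a u s : ℝ}
    (ha : 0 ≤ a) (hau : a ≤ u) (hus : u ≤ s) :
    ∫ ω, (∫ r in (0 : ℝ)..a, e r ω) * e a ω * (e u ω * e s ω) ∂P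
      = (1 - Real.exp (-2 * lam * a)) / (2 * lam) * Real.exp (-2 * lam * (s - u)) := by
  have h1 := h.expectation_pow_succ_mul 0 (Z := fun ω => e a ω * (e u ω * e s ω))
    ((h.measurable_space a).mul ((h.measurable_space u).mul (h.measurable_space s)))
    (fun ω => by simp [abs_mul, h.abs_eq]) ha
  simp only [zero_add, pow_one, Nat.cast_zero, one_mul, pow_zero] at h1
  have h2 : ∫ ω, (∫ r in (0 : ℝ)..a, e r ω) * e a ω * (e u ω * e s ω) ∂P
      = ∫ ω, (∫ r in (0 : ℝ)..a, e r ω) * (e a ω * (e u ω * e s ω)) ∂P := by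
    simp only [mul_assoc]
  rw [h2, h1, ← integral_exp_sub hlam, ← intervalIntegral.integral_mul_const]
  refine intervalIntegral.integral_congr fun b hb => ?_
  rw [uIcc_of_le ha] at hb
  rw [← h.integral_mul b a u s hb.1 hb.2 hau hus]
  simp only [mul_assoc]

theorem expectation_integral_sq_mul (h : IsParityProcess e lam P) (hlam : 0 < lam) {u s : ℝ}
    (hu : 0 ≤ u) (hus : u ≤ s) :
    ∫ ω, (∫ r in (0 : ℝ)..u, e r ω) ^ 2 * (e u ω * e s ω) ∂P
      = u ^ 2 * secondMomentRatio (lam * u) * Real.exp (-2 * lam * (s - u)) := by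
  have h1 := h.expectation_pow_succ_mul 1 (Z := fun ω => e u ω * e s ω)
    ((h.measurable_space u).mul (h.measurable_space s))
    (fun ω => by simp [abs_mul, h.abs_eq]) hu
  simp only [Nat.reduceAdd, Nat.cast_one, pow_one] at h1
  rw [h1, ← integral_one_sub_exp hlam hu, ← intervalIntegral.integral_mul_const]
  refine intervalIntegral.integral_congr fun a ha => ?_
  rw [uIcc_of_le hu] at ha
  rw [h.expectation_integral_mul hlam ha.1 ha.2 hus]
  ring

theorem expectation_integral_sq (h : IsParityProcess e lam P) (hlam : 0 < lam) {t : ℝ}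
    (ht : 0 ≤ t) :
    ∫ ω, (∫ r in (0 : ℝ)..t, e r ω) ^ 2 ∂P = t ^ 2 * secondMomentRatio (lam * t) := by
  have := h.expectation_integral_sq_mul hlam ht le_rfl
  simpa [h.mul_self] using this

/-- Two peelings reduce the fourth power to the square weighted by `e u * e s`, whose expectation is
known; the factors `4` and `3` come from differentiating the powers. -/
theorem expectation_integral_pow_four (h : IsParityProcess e lam P) (hlam : 0 < lam) {t : ℝ}
    (ht : 0 ≤ t) :
    ∫ ω, (∫ r in (0 : ℝ)..t, e r ω) ^ 4 ∂P = ∫ s in (0 : ℝ)..t, 4 * ∫ u in (0 : ℝ)..s,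
      3 * (u ^ 2 * secondMomentRatio (lam * u) * Real.exp (-2 * lam * (s - u))) := by
  have h1 := h.expectation_pow_succ_mul 3 (Z := fun _ => 1) measurable_const (by simp) ht
  simp only [mul_one, Nat.reduceAdd] at h1
  rw [h1]
  refine intervalIntegral.integral_congr fun s hs => ?_
  rw [uIcc_of_le ht] at hs
  have h2 := h.expectation_pow_succ_mul 2 (Z := e s) (h.measurable_space s)
    (fun ω => by simp [h.abs_eq]) hs.1
  simp only [Nat.reduceAdd] at h2
  rw [h2]
  norm_num only [Nat.cast_ofNat]
  congr 1
  refine intervalIntegral.integral_congr fun u hu => ?_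
  rw [uIcc_of_le hs.1] at hu
  rw [← h.expectation_integral_sq_mul hlam hu.1 hu.2]
  simp only [mul_assoc]

end IsParityProcess

/-! ### Small-time expansion of the fourth moment -/

theorem le_secondMomentRatio {x : ℝ} (hx : 0 ≤ x) : 1 - 2 / 3 * x ≤ secondMomentRatio x := by
  have := secondMomentRatio_sub_le le_rfl hx
  rw [secondMomentRatio_zero] at this
  linarith

theorem secondMomentRatio_le {x : ℝ} (hx : 0 ≤ x) :
    secondMomentRatio x ≤ 1 - 2 / 3 * x + 4 / 3 * x ^ 2 := by
  have := le_secondMomentRatio_sub le_rfl hx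
  rw [secondMomentRatio_zero] at this
  have h2 := Real.add_one_le_exp (-2 * x)
  nlinarith

theorem secondMomentRatio_nonneg (x : ℝ) : 0 ≤ secondMomentRatio x :=
  intervalIntegral.integral_nonneg zero_le_one fun u hu =>
    mul_nonneg (by linarith [hu.2]) (Real.exp_pos _).le

theorem secondMomentRatio_le_one {x : ℝ} (hx : 0 ≤ x) : secondMomentRatio x ≤ 1 := by
  rw [← secondMomentRatio_zero]
  exact secondMomentRatio_strictAntiOn.antitoneOn self_mem_Ici hx hx

theorem le_secondMomentRatio_mul_exp {x y : ℝ} (hx : 0 ≤ x) (hy : 0 ≤ y) :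
    1 - 2 / 3 * x - y ≤ secondMomentRatio x * Real.exp (-y) := by
  nlinarith [Real.add_one_le_exp (-y), le_secondMomentRatio hx, secondMomentRatio_nonneg x,
    secondMomentRatio_le_one hx,
    mul_le_mul_of_nonneg_left (Real.add_one_le_exp (-y)) (secondMomentRatio_nonneg x)]

/-- Follows from `(1 - y + y ^ 2) * (1 + y) = 1 + y ^ 3 ≥ 1` and `1 + y ≤ exp y`. -/
theorem exp_neg_le_quadratic {y : ℝ} (hy : 0 ≤ y) : Real.exp (-y) ≤ 1 - y + y ^ 2 := by
  have h1 := Real.add_one_le_exp y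
  rw [Real.exp_neg, inv_le_comm₀ (Real.exp_pos y) (by nlinarith)]
  refine le_trans ?_ h1
  rw [inv_le_iff_one_le_mul₀ (by nlinarith)]
  nlinarith [pow_nonneg hy 3]

theorem secondMomentRatio_mul_exp_le {x y : ℝ} (hx : 0 ≤ x) (hy : 0 ≤ y) :
    secondMomentRatio x * Real.exp (-y) ≤ 1 - 2 / 3 * x - y + 2 * (x + y) ^ 2 := by
  have h1 := mul_le_mul_of_nonneg_left (exp_neg_le_quadratic hy) (secondMomentRatio_nonneg x)
  have h2 := mul_le_mul_of_nonneg_right (le_secondMomentRatio hx) hy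
  have h3 := mul_le_mul_of_nonneg_right (secondMomentRatio_le_one hx) (sq_nonneg y)
  have h4 := secondMomentRatio_le hx
  nlinarith [mul_nonneg hx hy]

theorem integral_quadratic_cubic (s A B C : ℝ) :
    ∫ u in (0 : ℝ)..s, (A * u ^ 2 + B * u ^ 3 + C) = A * s ^ 3 / 3 + B * s ^ 4 / 4 + C * s := by
  rw [intervalIntegral.integral_add (Continuous.intervalIntegrable (by fun_prop) _ _)
    (Continuous.intervalIntegrable (by fun_prop) _ _),
    intervalIntegral.integral_add (Continuous.intervalIntegrable (by fun_prop) _ _)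
    (Continuous.intervalIntegrable (by fun_prop) _ _), intervalIntegral.integral_const_mul,
    intervalIntegral.integral_const_mul, integral_pow, integral_pow,
    intervalIntegral.integral_const]
  simp only [smul_eq_mul]
  push_cast
  ring

theorem integral_cubic_quintic (t A B C : ℝ) :
    ∫ u in (0 : ℝ)..t, (A * u ^ 3 + B * u ^ 4 + C * u ^ 5)
      = A * t ^ 4 / 4 + B * t ^ 5 / 5 + C * t ^ 6 / 6 := by
  rw [intervalIntegral.integral_add (Continuous.intervalIntegrable (by fun_prop) _ _)
    (Continuous.intervalIntegrable (by fun_prop) _ _),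
    intervalIntegral.integral_add (Continuous.intervalIntegrable (by fun_prop) _ _)
    (Continuous.intervalIntegrable (by fun_prop) _ _), intervalIntegral.integral_const_mul,
    intervalIntegral.integral_const_mul, intervalIntegral.integral_const_mul, integral_pow,
    integral_pow, integral_pow]
  push_cast
  ring

/-- The normalized fourth moment of the increment over `[0, t]`. -/
noncomputable def fourthMoment (lam t : ℝ) : ℝ :=
  ∫ s in (0 : ℝ)..t, 4 * ∫ u in (0 : ℝ)..s,
    3 * (u ^ 2 * secondMomentRatio (lam * u) * Real.exp (-2 * lam * (s - u)))

theorem continuous_fourthMoment_integrand (lam : ℝ) :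
    Continuous (Function.uncurry fun s u : ℝ =>
      3 * (u ^ 2 * secondMomentRatio (lam * u) * Real.exp (-2 * lam * (s - u)))) := by
  have := continuous_secondMomentRatio
  fun_prop

theorem continuous_fourthMoment_inner (lam : ℝ) : Continuous fun s : ℝ => 4 * ∫ u in (0 : ℝ)..s,
    3 * (u ^ 2 * secondMomentRatio (lam * u) * Real.exp (-2 * lam * (s - u))) :=
  (intervalIntegral.continuous_parametric_intervalIntegral_of_continuous
    (continuous_fourthMoment_integrand lam) continuous_id).const_mul 4

theorem le_fourthMoment {lam t : ℝ} (hlam : 0 < lam) (ht : 0 ≤ t) :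
    t ^ 4 - 4 / 5 * lam * t ^ 5 ≤ fourthMoment lam t := by
  have hpoly := integral_cubic_quintic t 4 (-4 * lam) 0
  have : t ^ 4 - 4 / 5 * lam * t ^ 5
      = ∫ u in (0 : ℝ)..t, (4 * u ^ 3 + -4 * lam * u ^ 4 + 0 * u ^ 5) := by rw [hpoly]; ring
  rw [this, fourthMoment]
  refine intervalIntegral.integral_mono_on ht (Continuous.intervalIntegrable (by fun_prop) _ _)
    ((continuous_fourthMoment_inner lam).intervalIntegrable _ _) fun s hs => ?_
  -- The polynomial is `3u ^ 2 * (1 - (2/3) lam u - 2 lam (s - u))`, the first-order expansion of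
  -- the integrand.
  have hpoly2 := integral_quadratic_cubic s (3 - 6 * lam * s) (4 * lam) 0
  have : 4 * s ^ 3 + -4 * lam * s ^ 4 + 0 * s ^ 5
      = 4 * ∫ u in (0 : ℝ)..s, ((3 - 6 * lam * s) * u ^ 2 + 4 * lam * u ^ 3 + 0) := by
    rw [hpoly2]; ring
  rw [this]
  refine mul_le_mul_of_nonneg_left ?_ (by norm_num)
  refine intervalIntegral.integral_mono_on hs.1 (Continuous.intervalIntegrable (by fun_prop) _ _)
    (((continuous_fourthMoment_integrand lam).comp
      (Continuous.prodMk_right s)).intervalIntegrable _ _) fun u hu => ?_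
  have hu0 := hu.1
  have h1 := le_secondMomentRatio_mul_exp (x := lam * u) (y := 2 * lam * (s - u)) (by positivity)
    (mul_nonneg (by positivity) (by linarith [hu.2]))
  have h2 : -2 * lam * (s - u) = -(2 * lam * (s - u)) := by ring
  rw [h2]
  nlinarith [mul_le_mul_of_nonneg_left h1 (sq_nonneg u)]

theorem fourthMoment_le {lam t : ℝ} (hlam : 0 < lam) (ht : 0 ≤ t) :
    fourthMoment lam t ≤ t ^ 4 - 4 / 5 * lam * t ^ 5 + 16 * lam ^ 2 * t ^ 6 := by
  have hpoly := integral_cubic_quintic t 4 (-4 * lam) (96 * lam ^ 2)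
  have : t ^ 4 - 4 / 5 * lam * t ^ 5 + 16 * lam ^ 2 * t ^ 6
      = ∫ u in (0 : ℝ)..t, (4 * u ^ 3 + -4 * lam * u ^ 4 + 96 * lam ^ 2 * u ^ 5) := by
    rw [hpoly]; ring
  rw [this, fourthMoment]
  refine intervalIntegral.integral_mono_on ht
    ((continuous_fourthMoment_inner lam).intervalIntegrable _ _)
    (Continuous.intervalIntegrable (by fun_prop) _ _) fun s hs => ?_
  -- The extra constant dominates the quadratic error: `3u ^ 2 * 2 * (2 lam s) ^ 2 ≤ 24 lam ^ 2 s ^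
  -- 4`. The two integrations turn it into `96 / 6 = 16`.
  have hpoly2 := integral_quadratic_cubic s (3 - 6 * lam * s) (4 * lam) (24 * lam ^ 2 * s ^ 4)
  have : 4 * s ^ 3 + -4 * lam * s ^ 4 + 96 * lam ^ 2 * s ^ 5
      = 4 * ∫ u in (0 : ℝ)..s,
        ((3 - 6 * lam * s) * u ^ 2 + 4 * lam * u ^ 3 + 24 * lam ^ 2 * s ^ 4) := by
    rw [hpoly2]; ring
  rw [this]
  refine mul_le_mul_of_nonneg_left ?_ (by norm_num)
  refine intervalIntegral.integral_mono_on hs.1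
    (((continuous_fourthMoment_integrand lam).comp
      (Continuous.prodMk_right s)).intervalIntegrable _ _)
    (Continuous.intervalIntegrable (by fun_prop) _ _) fun u hu => ?_
  have hu0 := hu.1
  have hs0 := hs.1
  have hsu : 0 ≤ s - u := by linarith [hu.2]
  have h1 := secondMomentRatio_mul_exp_le (x := lam * u) (y := 2 * lam * (s - u)) (by positivity)
    (by positivity)
  have h2 : -2 * lam * (s - u) = -(2 * lam * (s - u)) := by ring
  have h3 : (lam * u + 2 * lam * (s - u)) ^ 2 ≤ 4 * lam ^ 2 * s ^ 2 := by
    have : lam * u + 2 * lam * (s - u) ≤ 2 * lam * s := by nlinarith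
    calc _ ≤ (2 * lam * s) ^ 2 := by gcongr
      _ = _ := by ring
  have h4 : u ^ 2 * (8 * lam ^ 2 * s ^ 2) ≤ 8 * lam ^ 2 * s ^ 4 := by
    have : u ^ 2 ≤ s ^ 2 := pow_le_pow_left₀ hu0 hu.2 2
    calc _ ≤ s ^ 2 * (8 * lam ^ 2 * s ^ 2) := by gcongr
      _ = _ := by ring
  have h5 : u ^ 2 * (secondMomentRatio (lam * u) * Real.exp (-(2 * lam * (s - u))))
      ≤ u ^ 2 * (1 - 2 / 3 * (lam * u) - 2 * lam * (s - u) + 8 * lam ^ 2 * s ^ 2) :=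
    mul_le_mul_of_nonneg_left (by linarith) (sq_nonneg u)
  rw [h2]
  nlinarith

/-- The leading terms `t ^ 4` cancel in the variance, so its size is set by the next order: `-4/5`
from the fourth moment and `+4/3` from the squared mean give `8/15`. -/
theorem abs_fourthMoment_sub_le {lam t : ℝ} (hlam : 0 < lam) (ht : 0 ≤ t) (hlt : lam * t ≤ 1) :
    |fourthMoment lam t - (t ^ 2 * secondMomentRatio (lam * t)) ^ 2 - 8 / 15 * lam * t ^ 5|
      ≤ 16 * lam ^ 2 * t ^ 6 := by
  have hx : 0 ≤ lam * t := by positivity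
  obtain ⟨d, hd⟩ : ∃ d, secondMomentRatio (lam * t) = 1 - 2 / 3 * (lam * t) + d :=
    ⟨secondMomentRatio (lam * t) - (1 - 2 / 3 * (lam * t)), by ring⟩
  have hd0 : 0 ≤ d := by linarith [le_secondMomentRatio hx]
  have hd1 : d ≤ 4 / 3 * (lam * t) ^ 2 := by linarith [secondMomentRatio_le hx]
  have hsq0 : 1 - 4 / 3 * (lam * t) ≤ secondMomentRatio (lam * t) ^ 2 := by rw [hd]; nlinarith
  have hx2 : (lam * t) ^ 2 ≤ 1 := by nlinarith
  have hsq1 : secondMomentRatio (lam * t) ^ 2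
      ≤ 1 - 4 / 3 * (lam * t) + 16 * (lam * t) ^ 2 := by
    rw [hd]; nlinarith [mul_nonneg hx hd0]
  have h4 : 0 ≤ t ^ 4 := by positivity
  have e1 := mul_le_mul_of_nonneg_left hsq0 h4
  have e2 := mul_le_mul_of_nonneg_left hsq1 h4
  have l1 := le_fourthMoment hlam ht
  have l2 := fourthMoment_le hlam ht
  have hm : (t ^ 2 * secondMomentRatio (lam * t)) ^ 2
      = t ^ 4 * secondMomentRatio (lam * t) ^ 2 := by ring
  rw [hm, abs_le]
  constructor <;> nlinarith

theorem tendsto_fourthMoment_sub_div {lam : ℝ} (hlam : 0 < lam) {D : ℕ → ℝ} (hD : ∀ n, 0 < D n)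
    (hD0 : Tendsto D atTop (𝓝 0)) :
    Tendsto (fun n => (fourthMoment lam (D n)
      - (D n ^ 2 * secondMomentRatio (lam * D n)) ^ 2) / D n ^ 5) atTop (𝓝 (8 / 15 * lam)) := by
  rw [← tendsto_sub_nhds_zero_iff]
  have hlim : Tendsto (fun n => 16 * lam ^ 2 * D n) atTop (𝓝 0) := by
    simpa using hD0.const_mul (16 * lam ^ 2)
  refine squeeze_zero_norm' ?_ hlim
  have hsmall : ∀ᶠ n in atTop, lam * D n ≤ 1 := by
    have := hD0.const_mul lam
    rw [mul_zero] at this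
    exact this.eventually_le_const one_pos
  filter_upwards [hsmall] with n hn
  have h := abs_fourthMoment_sub_le hlam (hD n).le hn
  have hp : 0 < D n ^ 5 := pow_pos (hD n) 5
  rw [Real.norm_eq_abs, div_sub' hp.ne', abs_div, abs_of_pos hp, div_le_iff₀ hp]
  calc _ = |fourthMoment lam (D n) - (D n ^ 2 * secondMomentRatio (lam * D n)) ^ 2
        - 8 / 15 * lam * D n ^ 5| := by congr 1; ring
    _ ≤ _ := h
    _ = _ := by ring

/-! ### Laws and independence under almost sure limits -/

section Limits

variable {Ω : Type*} [MeasurableSpace Ω] {P : Measure Ω} [IsProbabilityMeasure P]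

/-- Almost sure convergence implies weak convergence of the laws, and weak limits are unique. -/
theorem identDistrib_of_ae_tendsto {X X' : ℕ → Ω → ℝ} {Y Y' : Ω → ℝ}
    (h : ∀ m, IdentDistrib (X m) (X' m) P P)
    (hX : ∀ᵐ ω ∂P, Tendsto (fun m => X m ω) atTop (𝓝 (Y ω)))
    (hX' : ∀ᵐ ω ∂P, Tendsto (fun m => X' m ω) atTop (𝓝 (Y' ω))) : IdentDistrib Y Y' P P := by
  have hm := fun m => (h m).aemeasurable_fst
  have hm' := fun m => (h m).aemeasurable_snd
  have hY := aemeasurable_of_tendsto_metrizable_ae atTop hm hX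
  have hY' := aemeasurable_of_tendsto_metrizable_ae atTop hm' hX'
  refine ⟨hY, hY', ?_⟩
  have h1 := (tendstoInDistribution_of_ae_tendsto hm hY hX).tendsto
  have h2 := (tendstoInDistribution_of_ae_tendsto hm' hY' hX').tendsto
  have : ∀ m, (⟨P.map (X m), Measure.isProbabilityMeasure_map (hm m)⟩ : ProbabilityMeasure ℝ)
      = ⟨P.map (X' m), Measure.isProbabilityMeasure_map (hm' m)⟩ :=
    fun m => Subtype.ext (h m).map_eq
  simp_rw [this] at h1
  exact congrArg ProbabilityMeasure.toMeasure (tendsto_nhds_unique h1 h2)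

/-- Independence passes to almost sure limits. -/
theorem iIndepFun_of_ae_tendsto {ι : Type*} [Fintype ι] {X : ℕ → ι → Ω → ℝ} {Y : ι → Ω → ℝ}
    (hm : ∀ m i, AEMeasurable (X m i) P) (hind : ∀ m, iIndepFun (X m) P)
    (hlim : ∀ i, ∀ᵐ ω ∂P, Tendsto (fun m => X m i ω) atTop (𝓝 (Y i ω))) : iIndepFun Y P := by
  have hY : ∀ i, AEMeasurable (Y i) P := fun i =>
    aemeasurable_of_tendsto_metrizable_ae atTop (fun m => hm m i) (hlim i)
  rw [iIndepFun_iff_map_fun_eq_pi_map hY]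
  have hjoint := (tendstoInDistribution_of_ae_tendsto (X := fun m ω i => X m i ω)
    (fun m => aemeasurable_pi_lambda _ (hm m)) (aemeasurable_pi_lambda _ hY)
    (by
      filter_upwards [ae_all_iff.2 hlim] with ω hω
      exact tendsto_pi_nhds.2 hω)).tendsto
  let μ : ℕ → ι → ProbabilityMeasure ℝ := fun m i =>
    ⟨P.map (X m i), Measure.isProbabilityMeasure_map (hm m i)⟩
  let ν : ι → ProbabilityMeasure ℝ := fun i =>
    ⟨P.map (Y i), Measure.isProbabilityMeasure_map (hY i)⟩
  have hmarg : Tendsto μ atTop (𝓝 ν) := tendsto_pi_nhds.2 fun i =>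
    (tendstoInDistribution_of_ae_tendsto (fun m => hm m i) (hY i) (hlim i)).tendsto
  have hpi := (ProbabilityMeasure.continuous_pi.tendsto ν).comp hmarg
  have heq : ∀ m, (⟨P.map (fun ω i => X m i ω), Measure.isProbabilityMeasure_map
      (aemeasurable_pi_lambda _ (hm m))⟩ : ProbabilityMeasure (ι → ℝ))
      = ProbabilityMeasure.pi (μ m) :=
    fun m => Subtype.ext ((hind m).map_fun_eq_pi_map (hm m))
  simp_rw [heq] at hjoint
  exact congrArg ProbabilityMeasure.toMeasure (tendsto_nhds_unique hjoint hpi)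

end Limits

/-! ### Blocks of i.i.d. sequences -/

section Blocks

variable {Ω : Type*} [MeasurableSpace Ω] {P : Measure Ω} {E : Type*} [MeasurableSpace E]

/-- Independence means that the joint law is a product measure, and a product over `ι × κ` is, after
currying, a product over `ι` of the row products. -/
theorem iIndepFun_curry {ι κ : Type*} {X : ι × κ → Ω → E} (hm : ∀ p, Measurable (X p))
    (h : iIndepFun X P) : iIndepFun (fun (i : ι) ω (j : κ) => X (i, j) ω) P := by
  have := h.isProbabilityMeasure
  have hprob : ∀ p, IsProbabilityMeasure (P.map (X p)) :=
    fun p => Measure.isProbabilityMeasure_map (hm p).aemeasurable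
  have hrow : ∀ i, P.map (fun ω (j : κ) => X (i, j) ω)
      = Measure.infinitePi fun j => P.map (X (i, j)) := fun i =>
    (h.precomp (g := fun j => (i, j)) (fun _ _ h => (Prod.ext_iff.1 h).2)).map_fun_eq_infinitePi_map
      (fun j => hm (i, j))
  have hblock : ∀ i, Measurable fun ω (j : κ) => X (i, j) ω := fun i =>
    measurable_pi_lambda _ fun j => hm (i, j)
  rw [iIndepFun_iff_map_fun_eq_infinitePi_map hblock]
  simp_rw [hrow]
  rw [← Measure.infinitePi_map_curry (μ := fun i j => P.map (X (i, j))),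
    ← h.map_fun_eq_infinitePi_map hm, Measure.map_map (MeasurableEquiv.measurable _)
      (measurable_pi_lambda _ hm)]
  rfl

/-- Consecutive blocks of length `M` of an i.i.d. sequence are i.i.d. -/
theorem iIndepFun_blocks {X : ℕ → Ω → E} (hm : ∀ k, Measurable (X k)) (h : iIndepFun X P)
    (M : ℕ) : iIndepFun (fun (i : ℕ) ω (j : Fin M) => X (i * M + j) ω) P := by
  refine iIndepFun_curry (X := fun p : ℕ × Fin M => X (p.1 * M + p.2)) (fun p => hm _)
    (h.precomp (g := fun p : ℕ × Fin M => p.1 * M + (p.2 : ℕ)) ?_)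
  rintro ⟨i, j⟩ ⟨i', j'⟩ hp
  have hM : 0 < M := j.pos
  have h1 : (i * M + j) / M = i := by
    rw [mul_comm, Nat.mul_add_div hM, Nat.div_eq_of_lt j.2, add_zero]
  have h2 : (i' * M + j') / M = i' := by
    rw [mul_comm, Nat.mul_add_div hM, Nat.div_eq_of_lt j'.2, add_zero]
  simp only at hp
  have hi : i = i' := by rw [← h1, hp, h2]
  subst hi
  simp only [Prod.mk.injEq, true_and]
  exact Fin.ext (by omega)

theorem identDistrib_blocks {X : ℕ → Ω → E} (hm : ∀ k, Measurable (X k)) (h : iIndepFun X P)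
    (hlaw : ∀ k, P.map (X k) = P.map (X 0)) (M i : ℕ) :
    IdentDistrib (fun ω (j : Fin M) => X (i * M + j) ω) (fun ω (j : Fin M) => X (0 * M + j) ω)
      P P := by
  have hblock : ∀ i, P.map (fun ω (j : Fin M) => X (i * M + j) ω)
      = Measure.pi fun _ => P.map (X 0) := by
    intro i
    rw [iIndepFun.map_fun_eq_pi_map (f := fun j : Fin M => X (i * M + j))
      (fun j => (hm _).aemeasurable)
      (h.precomp (g := fun j : Fin M => i * M + (j : ℕ)) fun a b hab => Fin.ext (by
        simpa using hab))]
    simp_rw [hlaw]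
  exact ⟨(measurable_pi_lambda _ fun j => hm _).aemeasurable,
    (measurable_pi_lambda _ fun j => hm _).aemeasurable, by rw [hblock, hblock]⟩

end Blocks

/-! ### Riemann sums and parity of the Poisson process -/

theorem abs_neg_one_pow_sub_le {a b : ℕ} (h : a ≤ b) :
    |(-1 : ℝ) ^ a - (-1) ^ b| ≤ 2 * ((b : ℝ) - a) := by
  rcases h.eq_or_lt with rfl | h
  · simp
  · have h1 : (1 : ℝ) ≤ (b : ℝ) - a := by
      have : ((a + 1 : ℕ) : ℝ) ≤ b := by exact_mod_cast h
      push_cast at this; linarith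
    have := abs_sub ((-1 : ℝ) ^ a) ((-1) ^ b)
    simp only [abs_pow, abs_neg, abs_one, one_pow] at this
    linarith

theorem measurable_neg_one_pow {K : ℝ → ℕ} (hK : Monotone K) :
    Measurable fun s => (-1 : ℝ) ^ K s :=
  (measurable_from_nat (f := fun k : ℕ => (-1 : ℝ) ^ k)).comp hK.measurable

theorem intervalIntegrable_neg_one_pow {K : ℝ → ℕ} (hK : Monotone K) (a b : ℝ) :
    IntervalIntegrable (fun s => (-1 : ℝ) ^ K s) volume a b :=
  (intervalIntegrable_const (c := (1 : ℝ))).mono_fun (measurable_neg_one_pow hK).aestronglyMeasurable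
    (Eventually.of_forall fun s => by simp)

/-- Error of the right Riemann sums for the parity of a monotone step function. -/
theorem abs_integral_neg_one_pow_sub_sum_le {K : ℝ → ℕ} (hK : Monotone K) (a : ℝ) {h : ℝ}
    (hh : 0 ≤ h) (M : ℕ) :
    |(∫ s in a..(a + M * h), (-1 : ℝ) ^ K s)
      - h * ∑ j ∈ Finset.range M, (-1 : ℝ) ^ K (a + (j + 1 : ℕ) * h)|
      ≤ 2 * h * ((K (a + M * h) : ℝ) - K a) := by
  induction M with
  | zero => simp
  | succ M ih =>
    have hle : a + M * h ≤ a + (M + 1 : ℕ) * h := by push_cast; nlinarith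
    -- On one step the error is at most `2h` times the growth of `K` there; these growths telescope.
    have hstep : |(∫ s in (a + M * h)..(a + (M + 1 : ℕ) * h), (-1 : ℝ) ^ K s)
        - h * (-1 : ℝ) ^ K (a + (M + 1 : ℕ) * h)|
        ≤ 2 * h * ((K (a + (M + 1 : ℕ) * h) : ℝ) - K (a + M * h)) := by
      have hlen : a + (M + 1 : ℕ) * h - (a + M * h) = h := by push_cast; ring
      have hc : h * (-1 : ℝ) ^ K (a + (M + 1 : ℕ) * h)
          = ∫ s in (a + M * h)..(a + (M + 1 : ℕ) * h), (-1 : ℝ) ^ K (a + (M + 1 : ℕ) * h) := by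
        rw [intervalIntegral.integral_const, hlen, smul_eq_mul]
      rw [hc, ← intervalIntegral.integral_sub (intervalIntegrable_neg_one_pow hK _ _)
        intervalIntegrable_const]
      have := intervalIntegral.norm_integral_le_of_norm_le_const
        (f := fun s => (-1 : ℝ) ^ K s - (-1) ^ K (a + (M + 1 : ℕ) * h))
        (a := a + M * h) (b := a + (M + 1 : ℕ) * h)
        (C := 2 * ((K (a + (M + 1 : ℕ) * h) : ℝ) - K (a + M * h))) ?_
      · rw [hlen, abs_of_nonneg hh, Real.norm_eq_abs] at this
        linarith
      · intro s hs
        rw [uIoc_of_le hle] at hs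
        rw [Real.norm_eq_abs]
        refine (abs_neg_one_pow_sub_le (hK hs.2)).trans ?_
        have : (K (a + M * h) : ℝ) ≤ K s := by exact_mod_cast hK hs.1.le
        linarith
    rw [Finset.sum_range_succ, ← intervalIntegral.integral_add_adjacent_intervals
      (intervalIntegrable_neg_one_pow hK a (a + M * h)) (intervalIntegrable_neg_one_pow hK _ _)]
    calc _ = |((∫ s in a..(a + M * h), (-1 : ℝ) ^ K s)
          - h * ∑ j ∈ Finset.range M, (-1 : ℝ) ^ K (a + (j + 1 : ℕ) * h))
          + ((∫ s in (a + M * h)..(a + (M + 1 : ℕ) * h), (-1 : ℝ) ^ K s)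
          - h * (-1 : ℝ) ^ K (a + (M + 1 : ℕ) * h))| := by congr 1; ring
      _ ≤ _ := abs_add_le _ _
      _ ≤ _ := add_le_add ih hstep
      _ = _ := by ring

theorem tendsto_riemannSum_neg_one_pow {K : ℝ → ℕ} (hK : Monotone K) (a : ℝ) {D : ℝ}
    (hD : 0 ≤ D) :
    Tendsto (fun m : ℕ => D / (m + 1 : ℕ) * ∑ j ∈ Finset.range (m + 1),
      (-1 : ℝ) ^ K (a + (j + 1 : ℕ) * (D / (m + 1 : ℕ)))) atTop
      (𝓝 (∫ s in a..(a + D), (-1 : ℝ) ^ K s)) := by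
  have hlim : Tendsto (fun m : ℕ => 2 * (D / (m + 1 : ℕ)) * ((K (a + D) : ℝ) - K a)) atTop
      (𝓝 0) := by
    have h1 : Tendsto (fun m : ℕ => D / (m + 1 : ℕ)) atTop (𝓝 0) :=
      (tendsto_const_div_atTop_nhds_zero_nat D).comp (tendsto_add_atTop_nat 1)
    simpa using (h1.const_mul 2).mul_const ((K (a + D) : ℝ) - K a)
  rw [tendsto_iff_norm_sub_tendsto_zero]
  refine squeeze_zero (fun _ => norm_nonneg _) (fun m => ?_) hlim
  have h := abs_integral_neg_one_pow_sub_sum_le hK a (h := D / (m + 1 : ℕ)) (by positivity) (m + 1)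
  have hm : ((m + 1 : ℕ) : ℝ) * (D / (m + 1 : ℕ)) = D := by
    have : ((m + 1 : ℕ) : ℝ) ≠ 0 := by positivity
    field_simp
  rw [hm] at h
  rw [norm_sub_rev, Real.norm_eq_abs]
  exact h

theorem measurable_uncurry_of_rightCont {Ω : Type*} [MeasurableSpace Ω] {e : ℝ → Ω → ℝ}
    (hm : ∀ s, Measurable (e s)) (hr : ∀ ω s, ContinuousWithinAt (fun r => e r ω) (Ici s) s) :
    Measurable (Function.uncurry e) := by
  refine measurable_of_tendsto_metrizable
    -- Adding one to the floor puts the grid point to the right of `p.1`, where right-continuity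
    -- applies.
    (f := fun (n : ℕ) (p : ℝ × Ω) => e (((⌊(n + 1 : ℕ) * p.1⌋ : ℝ) + 1) / (n + 1 : ℕ)) p.2)
    (fun n => ?_) ?_
  · have h1 : Measurable (Function.uncurry fun (k : ℤ) ω => e (((k : ℝ) + 1) / (n + 1 : ℕ)) ω) :=
      measurable_from_prod_countable_right fun k => hm (((k : ℝ) + 1) / (n + 1 : ℕ))
    have h2 : Measurable fun p : ℝ × Ω => ((⌊((n + 1 : ℕ) : ℝ) * p.1⌋ : ℤ), p.2) :=
      ((Int.measurable_floor.comp (measurable_fst.const_mul _))).prodMk measurable_snd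
    exact h1.comp h2
  · refine tendsto_pi_nhds.2 fun p => ?_
    have hlow : ∀ n : ℕ, p.1 ≤ ((⌊((n + 1 : ℕ) : ℝ) * p.1⌋ : ℝ) + 1) / (n + 1 : ℕ) := by
      intro n
      rw [le_div_iff₀ (by positivity), mul_comm]
      exact (Int.lt_floor_add_one _).le
    have hup : ∀ n : ℕ, ((⌊((n + 1 : ℕ) : ℝ) * p.1⌋ : ℝ) + 1) / (n + 1 : ℕ)
        ≤ p.1 + 1 / (n + 1 : ℕ) := by
      intro n
      have hpos : (0 : ℝ) < (n + 1 : ℕ) := by positivity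
      rw [div_le_iff₀ hpos, add_mul, div_mul_cancel₀ _ hpos.ne', mul_comm p.1]
      have := Int.floor_le (((n + 1 : ℕ) : ℝ) * p.1)
      linarith
    have h0 : Tendsto (fun n : ℕ => p.1 + 1 / ((n + 1 : ℕ) : ℝ)) atTop (𝓝 p.1) := by
      simpa using (tendsto_one_div_add_atTop_nhds_zero_nat (𝕜 := ℝ)).const_add p.1
    have hlim : Tendsto (fun n : ℕ => ((⌊((n + 1 : ℕ) : ℝ) * p.1⌋ : ℝ) + 1) / (n + 1 : ℕ)) atTop
        (𝓝[Ici p.1] p.1) :=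
      tendsto_nhdsWithin_iff.2 ⟨tendsto_of_tendsto_of_tendsto_of_le_of_le tendsto_const_nhds h0
        hlow hup, Eventually.of_forall hlow⟩
    exact (hr p.2 p.1).tendsto.comp hlim

theorem integral_neg_one_pow_poissonMeasure (r : ℝ≥0) :
    ∫ k, (-1 : ℝ) ^ k ∂(poissonMeasure r) = Real.exp (-2 * r) := by
  rw [integral_poissonMeasure]
  have := (NormedSpace.expSeries_div_hasSum_exp (-(r : ℝ))).mul_left (Real.exp (-r))
  rw [← Real.exp_eq_exp_ℝ, ← Real.exp_add] at this
  have h2 : -2 * (r : ℝ) = -r + -r := by ring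
  rw [h2, ← this.tsum_eq]
  refine tsum_congr fun k => ?_
  rw [neg_pow (r : ℝ), smul_eq_mul]
  ring

theorem neg_one_pow_mul_neg_one_pow {a b : ℕ} (h : a ≤ b) :
    (-1 : ℝ) ^ a * (-1) ^ b = (-1) ^ (b - a) := by
  obtain ⟨c, rfl⟩ := Nat.exists_eq_add_of_le h
  rw [Nat.add_sub_cancel_left, pow_add, ← mul_assoc, ← pow_add, Even.neg_one_pow ⟨a, rfl⟩, one_mul]

namespace IsPoissonProcess

variable {Ω : Type*} [MeasurableSpace Ω] {P : Measure Ω}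
  {N : ℝ≥0 → Ω → ℕ} {lam : ℝ≥0}

theorem expectation_parity_increment (h : IsPoissonProcess N lam P) {s t : ℝ≥0} (hst : s ≤ t) :
    ∫ ω, (-1 : ℝ) ^ (N t ω - N s ω) ∂P = Real.exp (-2 * lam * (t - s)) := by
  have := (h.law_increment s t hst).integral_comp (f := fun k : ℕ => (-1 : ℝ) ^ k)
    (Measurable.of_discrete.aestronglyMeasurable)
  rw [integral_neg_one_pow_poissonMeasure] at this
  rw [NNReal.coe_mul, NNReal.coe_sub hst, ← mul_assoc] at this
  exact this

/-- The four signs pair up into the parities of the increments over `(b, a]` and `(u, s]`, which are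
independent. -/
theorem expectation_parity (h : IsPoissonProcess N lam P) {b a u s : ℝ≥0} (hba : b ≤ a)
    (hau : a ≤ u) (hus : u ≤ s) :
    ∫ ω, (-1 : ℝ) ^ N b ω * (-1) ^ N a ω * (-1) ^ N u ω * (-1) ^ N s ω ∂P
      = Real.exp (-2 * lam * (a - b)) * Real.exp (-2 * lam * (s - u)) := by
  let t : ℕ → ℝ≥0
    | 0 => b
    | 1 => a
    | 2 => u
    | _ => s
  have ht : Monotone t := by
    refine monotone_nat_of_le_succ fun n => ?_
    match n with
    | 0 => exact hba
    | 1 => exact hau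
    | 2 => exact hus
    | n + 3 => exact le_rfl
  have hind : IndepFun (fun ω => N a ω - N b ω) (fun ω => N s ω - N u ω) P :=
    (h.indepIncrements.nat ht).indepFun (i := 0) (j := 2) (by norm_num)
  have hind2 := hind.comp (φ := fun k : ℕ => (-1 : ℝ) ^ k) (ψ := fun k : ℕ => (-1 : ℝ) ^ k)
    Measurable.of_discrete Measurable.of_discrete
  have hmeas : ∀ x y : ℝ≥0, AEStronglyMeasurable
      ((fun k : ℕ => (-1 : ℝ) ^ k) ∘ fun ω => N x ω - N y ω) P := fun x y =>
    ((Measurable.of_discrete (f := fun k : ℕ => (-1 : ℝ) ^ k)).comp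
      ((h.measurable x).sub (h.measurable y))).aestronglyMeasurable
  rw [← h.expectation_parity_increment hba, ← h.expectation_parity_increment hus]
  have := hind2.integral_fun_mul_eq_mul_integral (hmeas _ _) (hmeas _ _)
  simp only [Function.comp_def] at this
  rw [← this]
  refine integral_congr_ae ?_
  filter_upwards [h.path] with ω hω
  rw [← neg_one_pow_mul_neg_one_pow (hω.1 hba), ← neg_one_pow_mul_neg_one_pow (hω.1 hus)]
  ring

/-- Up to a null set, the parity of a Poisson process is a parity process. -/
theorem exists_parityProcess_version (h : IsPoissonProcess N lam P) :
    ∃ e : ℝ → Ω → ℝ, IsParityProcess e lam P ∧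
      ∀ᵐ ω ∂P, ∀ s : ℝ, e s ω = (-1) ^ N s.toNNReal ω := by
  classical
  obtain ⟨A, hAP, hAm, hA⟩ := h.path.exists_measurable_mem
  have hAae : ∀ᵐ ω ∂P, ω ∈ A := hAP
  -- The constant path `1` on the exceptional null set makes right-continuity hold for every `ω`, as
  -- joint measurability requires.
  let e : ℝ → Ω → ℝ := fun s ω => if ω ∈ A then (-1) ^ N s.toNNReal ω else 1
  have hes : ∀ᵐ ω ∂P, ∀ s : ℝ, e s ω = (-1) ^ N s.toNNReal ω := by
    filter_upwards [hAae] with ω hω s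
    simp only [e, hω, if_true]
  have hright : ∀ ω s, ContinuousWithinAt (fun r => e r ω) (Ici s) s := by
    intro ω s
    by_cases hω : ω ∈ A
    · simp only [e, hω, if_true]
      have h1 : ContinuousWithinAt (fun r : ℝ => N r.toNNReal ω) (Ici s) s :=
        ContinuousWithinAt.comp (g := fun r => N r ω) ((hA ω hω).2 s.toNNReal)
          continuous_real_toNNReal.continuousWithinAt fun r hr => Real.toNNReal_mono hr
      exact (continuous_of_discreteTopology
        (f := fun k : ℕ => (-1 : ℝ) ^ k)).continuousAt.comp_continuousWithinAt h1
    · simp only [e, hω, if_false]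
      exact continuousWithinAt_const
  have hmeas : ∀ s, Measurable (e s) := fun s =>
    Measurable.ite hAm ((Measurable.of_discrete (f := fun k : ℕ => (-1 : ℝ) ^ k)).comp
      (h.measurable _)) measurable_const
  refine ⟨e, ⟨measurable_uncurry_of_rightCont hmeas hright, fun s ω => ?_, hright,
    fun b a u s hb hba hau hus => ?_⟩, hes⟩
  · by_cases hω : ω ∈ A
    · simp only [e, hω, if_true, ← pow_add]
      exact Even.neg_one_pow ⟨_, rfl⟩
    · simp only [e, hω, if_false, mul_one]
  · have ha := hb.trans hba
    have hu := ha.trans hau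
    have := h.expectation_parity (Real.toNNReal_mono hba) (Real.toNNReal_mono hau)
      (Real.toNNReal_mono hus)
    rw [Real.coe_toNNReal _ hb, Real.coe_toNNReal _ ha, Real.coe_toNNReal _ hu,
      Real.coe_toNNReal _ (hu.trans hus)] at this
    rw [← this]
    refine integral_congr_ae ?_
    filter_upwards [hes] with ω hω
    rw [hω, hω, hω, hω]

end IsPoissonProcess

/-! ### The squared cell displacements are i.i.d. -/

/-- The squared displacement over the cell `(iD, (i+1)D]` at unit speed. -/
noncomputable def cellSq {Ω : Type*} (N : ℝ≥0 → Ω → ℕ) (D : ℝ) (i : ℕ) (ω : Ω) : ℝ :=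
  (∫ s in (i * D)..((i + 1 : ℕ) * D), (-1 : ℝ) ^ N s.toNNReal ω) ^ 2

theorem cellSq_le {Ω : Type*} (N : ℝ≥0 → Ω → ℕ) {D : ℝ} (hD : 0 ≤ D) (i : ℕ) (ω : Ω) :
    cellSq N D i ω ≤ D ^ 2 := by
  have := intervalIntegral.norm_integral_le_of_norm_le_const (C := 1)
    (f := fun s : ℝ => (-1 : ℝ) ^ N s.toNNReal ω) (a := i * D) (b := (i + 1 : ℕ) * D)
    fun s _ => by simp
  have hlen : ((i + 1 : ℕ) : ℝ) * D - i * D = D := by push_cast; ring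
  rw [hlen, one_mul, abs_of_nonneg hD, Real.norm_eq_abs] at this
  rw [cellSq, ← sq_abs]
  gcongr

theorem cellSq_nonneg {Ω : Type*} (N : ℝ≥0 → Ω → ℕ) (D : ℝ) (i : ℕ) (ω : Ω) : 0 ≤ cellSq N D i ω := sq_nonneg _

/-- The squared Riemann sum of the parity on a cell as a function of the increments. -/
noncomputable def riemannSq (D : ℝ) (M : ℕ) (x : Fin M → ℕ) : ℝ :=
  (D / M * ∑ j ∈ Finset.range M,
    (-1 : ℝ) ^ ∑ l ∈ Finset.range (j + 1), if hl : l < M then x ⟨l, hl⟩ else 0) ^ 2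

namespace IsPoissonProcess

variable {Ω : Type*} [MeasurableSpace Ω] {P : Measure Ω}
  {N : ℝ≥0 → Ω → ℕ} {lam : ℝ≥0}

/-- The parity at the left end of the cell is a common sign of the whole Riemann sum and vanishes on
squaring. Hence `cellSq` is a limit of one fixed function per mesh, evaluated at the increments
inside the cell. -/
theorem tendsto_riemannSq (h : IsPoissonProcess N lam P) {D : ℝ} (hD : 0 ≤ D) (i : ℕ) :
    ∀ᵐ ω ∂P, Tendsto (fun m : ℕ => riemannSq D (m + 1) fun j : Fin (m + 1) =>
      N (((i * (m + 1) + j + 1 : ℕ) : ℝ≥0) * (D / (m + 1 : ℕ)).toNNReal) ω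
        - N (((i * (m + 1) + j : ℕ) : ℝ≥0) * (D / (m + 1 : ℕ)).toNNReal) ω) atTop
      (𝓝 (cellSq N D i ω)) := by
  filter_upwards [h.path] with ω hω
  have hK : Monotone fun s : ℝ => N s.toNNReal ω := 
    fun s t hst => hω.1 (Real.toNNReal_mono hst)
  have hlim := (tendsto_riemannSum_neg_one_pow hK (i * D) hD).pow 2
  have hend : (i : ℝ) * D + D = (i + 1 : ℕ) * D := by push_cast; ring
  rw [hend] at hlim
  refine hlim.congr fun m => ?_
  set M := m + 1 with hM
  have hM0 : (M : ℝ) ≠ 0 := by positivity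
  set d : ℝ≥0 := (D / M).toNNReal with hd
  have hdR : (d : ℝ) = D / M := Real.coe_toNNReal _ (by positivity)
  have hpoint : ∀ k : ℕ, ((i : ℝ) * D + k * (D / M)).toNNReal = ((i * M + k : ℕ) : ℝ≥0) * d := by
    intro k
    rw [← Real.toNNReal_coe (r := ((i * M + k : ℕ) : ℝ≥0) * d)]
    congr 1
    push_cast
    rw [hdR]
    field_simp
  let f : ℕ → ℕ := fun k => N (((i * M + k : ℕ) : ℝ≥0) * d) ω
  have hf : Monotone f := fun k k' hk => hω.1 (by gcongr)
  have hsum : ∀ j ∈ Finset.range M, (∑ l ∈ Finset.range (j + 1), if hl : l < M then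
      (fun j : Fin M => N (((i * M + j + 1 : ℕ) : ℝ≥0) * d) ω
        - N (((i * M + j : ℕ) : ℝ≥0) * d) ω) ⟨l, hl⟩ else 0) = f (j + 1) - f 0 := by
    intro j hj
    rw [← Finset.sum_range_tsub hf]
    refine Finset.sum_congr rfl fun l hl => ?_
    have hlM : l < M := by
      rw [Finset.mem_range] at hl hj; omega
    -- Here `l ≤ j < M`, so the default value `0` in `riemannSq` never enters.
    rw [dif_pos hlM]
    rfl
  simp only [riemannSq]
  rw [Finset.sum_congr rfl fun j hj => congrArg (fun k : ℕ => (-1 : ℝ) ^ k) (hsum j hj)]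
  have hsign : ∀ j ∈ Finset.range M, (-1 : ℝ) ^ N ((i : ℝ) * D + (j + 1 : ℕ) * (D / M)).toNNReal ω
      = (-1) ^ f 0 * (-1) ^ (f (j + 1) - f 0) := by
    intro j _
    rw [hpoint, ← neg_one_pow_mul_neg_one_pow (hf (Nat.zero_le (j + 1))), ← mul_assoc, ← pow_add,
      Even.neg_one_pow ⟨_, rfl⟩, one_mul]
  rw [Finset.sum_congr rfl hsign, ← Finset.mul_sum, mul_left_comm, mul_pow ((-1 : ℝ) ^ f 0),
    ← pow_mul, Even.neg_one_pow (Nat.even_mul.2 (Or.inr even_two)), one_mul]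

theorem iIndepFun_increments (h : IsPoissonProcess N lam P) (d : ℝ≥0) :
    iIndepFun (fun (k : ℕ) ω => N (((k + 1 : ℕ) : ℝ≥0) * d) ω - N ((k : ℝ≥0) * d) ω) P :=
  h.indepIncrements.nat (t := fun k : ℕ => (k : ℝ≥0) * d) fun k k' hk => by
    simp only; gcongr

theorem measurable_increment (h : IsPoissonProcess N lam P) (d : ℝ≥0) (k : ℕ) :
    Measurable fun ω => N (((k + 1 : ℕ) : ℝ≥0) * d) ω - N ((k : ℝ≥0) * d) ω :=
  (h.measurable _).sub (h.measurable _)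

theorem map_increment (h : IsPoissonProcess N lam P) (d : ℝ≥0) (k : ℕ) :
    P.map (fun ω => N (((k + 1 : ℕ) : ℝ≥0) * d) ω - N ((k : ℝ≥0) * d) ω)
      = poissonMeasure (lam * d) := by
  have hle : (k : ℝ≥0) * d ≤ ((k + 1 : ℕ) : ℝ≥0) * d := by gcongr; simp
  rw [(h.law_increment _ _ hle).map_eq]
  congr 2
  push_cast
  rw [add_mul, one_mul, add_tsub_cancel_left]

variable [IsProbabilityMeasure P]

/-- At every mesh, distinct cells use disjoint blocks of independent increments; independence
survives the refinement limit. -/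
theorem iIndepFun_cellSq (h : IsPoissonProcess N lam P) {D : ℝ} (hD : 0 ≤ D) (n : ℕ) :
    iIndepFun (fun i : Fin n => cellSq N D i) P := by
  refine iIndepFun_of_ae_tendsto (X := fun m (i : Fin n) ω =>
    riemannSq D (m + 1) fun j : Fin (m + 1) =>
      N (((i * (m + 1) + j + 1 : ℕ) : ℝ≥0) * (D / (m + 1 : ℕ)).toNNReal) ω
        - N (((i * (m + 1) + j : ℕ) : ℝ≥0) * (D / (m + 1 : ℕ)).toNNReal) ω)
    (fun m i => ?_) (fun m => ?_) fun i => h.tendsto_riemannSq hD i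
  · exact ((Measurable.of_discrete (f := riemannSq D (m + 1))).comp (measurable_pi_lambda _ fun j =>
      h.measurable_increment _ _)).aemeasurable
  · have hb := iIndepFun_blocks (h.measurable_increment (D / (m + 1 : ℕ)).toNNReal)
      (h.iIndepFun_increments (D / (m + 1 : ℕ)).toNNReal) (m + 1)
    exact (hb.comp (fun _ => riemannSq D (m + 1)) fun _ => Measurable.of_discrete).precomp
      Fin.val_injective

theorem identDistrib_cellSq (h : IsPoissonProcess N lam P) {D : ℝ} (hD : 0 ≤ D) (i : ℕ) :
    IdentDistrib (cellSq N D i) (cellSq N D 0) P P := by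
  refine identDistrib_of_ae_tendsto (fun m => ?_) (h.tendsto_riemannSq hD i)
    (h.tendsto_riemannSq hD 0)
  exact (identDistrib_blocks (h.measurable_increment (D / (m + 1 : ℕ)).toNNReal)
    (h.iIndepFun_increments (D / (m + 1 : ℕ)).toNNReal)
    (fun k => by rw [h.map_increment, h.map_increment]) (m + 1) i).comp
    (Measurable.of_discrete (f := riemannSq D (m + 1)))

theorem integral_cellSq (h : IsPoissonProcess N lam P) (hlam : 0 < lam) {D : ℝ} (hD : 0 ≤ D) :
    ∫ ω, cellSq N D 0 ω ∂P = D ^ 2 * secondMomentRatio (lam * D) := by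
  obtain ⟨e, he, hae⟩ := h.exists_parityProcess_version
  rw [← he.expectation_integral_sq hlam hD]
  refine integral_congr_ae ?_
  filter_upwards [hae] with ω hω
  simp [cellSq, hω]

theorem integral_cellSq_sq (h : IsPoissonProcess N lam P) (hlam : 0 < lam) {D : ℝ} (hD : 0 ≤ D) :
    ∫ ω, cellSq N D 0 ω ^ 2 ∂P = fourthMoment lam D := by
  obtain ⟨e, he, hae⟩ := h.exists_parityProcess_version
  rw [fourthMoment, ← he.expectation_integral_pow_four hlam hD]
  refine integral_congr_ae ?_
  filter_upwards [hae] with ω hω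
  simp [cellSq, hω, ← pow_mul]

end IsPoissonProcess

/-! ### Linearization and the normalized error -/

/-- Linearization of the moment equation around the true parameter. -/
theorem moment_solution_bound {lam D R S : ℝ} (hlam : 0 < lam) (hD : 0 < D)
    (hsmall : lam * D < 1 / 32) (hR : |R| ≤ 3 / 4 * lam)
    (hS : S = secondMomentRatio (lam * D) - 2 / 3 * (D * R)) :
    0 < S ∧ S < 1 ∧ ∀ l, 0 < l * D → secondMomentRatio (l * D) = S →
      |l - lam - R| ≤ 16 * (lam * D) * |R| := by
  set x := lam * D with hx
  have hx0 : 0 < x := mul_pos hlam hD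
  have hDR : |D * R| ≤ 3 / 4 * x := by
    rw [abs_mul, abs_of_pos hD, hx]
    calc D * |R| ≤ D * (3 / 4 * lam) := by gcongr
      _ = _ := by ring
  have hDR' := abs_le.1 hDR
  have h1 := le_secondMomentRatio hx0.le
  have h2 := le_secondMomentRatio_sub le_rfl hx0.le
  rw [secondMomentRatio_zero] at h2
  have h3 := Real.add_one_le_exp (-2 * x)
  -- The perturbation of `S` is at most `x / 2`, less than the drop `(2/3) x * exp (-2x)` of the
  -- ratio below `1`, since `x < 1/32`.
  refine ⟨by linarith, ?_, fun l hl0 hl => ?_⟩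
  · nlinarith
  set y := l * D with hy
  have hdiff : secondMomentRatio x - secondMomentRatio y = 2 / 3 * (D * R) := by
    rw [hl, hS]; ring
  -- A priori bound: between `x` and `4x` the ratio drops by at least `2x(1 - 8x)`, more than the
  -- available `x / 2`.
  have hy4 : y ≤ 4 * x := by
    by_contra! hlt
    have h4 := le_secondMomentRatio_sub hx0.le (by linarith : x ≤ 4 * x)
    have h5 := secondMomentRatio_strictAntiOn.antitoneOn
      (mem_Ici.2 (by positivity : (0 : ℝ) ≤ 4 * x)) hl0.le hlt.le
    have h6 := Real.add_one_le_exp (-2 * (4 * x))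
    nlinarith
  have hexp : ∀ z, z ≤ 4 * x → 1 - 8 * x ≤ Real.exp (-2 * z) := fun z hz => by
    have := Real.add_one_le_exp (-2 * z); linarith
  -- Below `4x` the difference quotients lie between `-2/3` and `-(2/3)(1 - 8x)`.
  have hkey : |(y - x) - D * R| ≤ 8 * x * |y - x| := by
    rcases le_total x y with hxy | hxy
    · have h4 := le_secondMomentRatio_sub hx0.le hxy
      have h5 := secondMomentRatio_sub_le hx0.le hxy
      have h6 := mul_le_mul_of_nonneg_right (hexp y hy4) (sub_nonneg.2 hxy)
      rw [abs_of_nonneg (sub_nonneg.2 hxy), abs_le]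
      constructor <;> nlinarith [mul_nonneg hx0.le (sub_nonneg.2 hxy)]
    · have h4 := le_secondMomentRatio_sub hl0.le hxy
      have h5 := secondMomentRatio_sub_le hl0.le hxy
      have h6 := mul_le_mul_of_nonneg_right (hexp x (by linarith)) (sub_nonneg.2 hxy)
      rw [abs_of_nonpos (sub_nonpos.2 hxy), abs_le]
      constructor <;> nlinarith [mul_nonneg hx0.le (sub_nonneg.2 hxy)]
  have hfac : (y - x) - D * R = D * (l - lam - R) := by rw [hx, hy]; ring
  have hfac2 : y - x = D * (l - lam) := by rw [hx, hy]; ring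
  rw [hfac, hfac2, abs_mul, abs_mul, abs_of_pos hD] at hkey
  have hkey2 : |l - lam - R| ≤ 8 * x * |l - lam| := by
    refine le_of_mul_le_mul_left ?_ hD
    linarith
  have htri : |l - lam| ≤ |l - lam - R| + |R| := by
    calc |l - lam| = |(l - lam - R) + R| := by ring_nf
      _ ≤ _ := abs_add_le _ _
  -- As `8x < 1/4`, the term `8x * |l - lam|` is absorbed into the left side.
  have hle : |l - lam| ≤ 2 * |R| := by nlinarith [abs_nonneg (l - lam), abs_nonneg R]
  calc |l - lam - R| ≤ 8 * x * |l - lam| := hkey2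
    _ ≤ 8 * x * (2 * |R|) := by gcongr
    _ = _ := by ring

/-- The centred and normalized contribution of the `i`-th cell to the moment equation. -/
noncomputable def normalizedCell {Ω : Type*} (N : ℝ≥0 → Ω → ℕ) (lam D T : ℝ) (i : ℕ) (ω : Ω) : ℝ :=
  3 / 2 * (D ^ 2 * secondMomentRatio (lam * D) - cellSq N D i ω) / (√T * D ^ 2)

theorem abs_normalizedCell_le {Ω : Type*} (N : ℝ≥0 → Ω → ℕ) {lam : ℝ} (hlam : 0 ≤ lam) {D : ℝ} (hD : 0 < D)
    (T : ℝ) (i : ℕ) (ω : Ω) : |normalizedCell N lam D T i ω| ≤ 3 / 2 / √T := by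
  have hx : 0 ≤ lam * D := by positivity
  have h1 := cellSq_nonneg N D i ω
  have h2 := cellSq_le N hD.le i ω
  have h3 := mul_le_mul_of_nonneg_left (secondMomentRatio_le_one hx) (sq_nonneg D)
  have h4 := mul_nonneg (sq_nonneg D) (secondMomentRatio_nonneg (lam * D))
  have h5 : |D ^ 2 * secondMomentRatio (lam * D) - cellSq N D i ω| ≤ D ^ 2 := by
    rw [abs_le]; constructor <;> linarith
  have hD2 : 0 < D ^ 2 := by positivity
  rw [normalizedCell, abs_div, abs_mul, abs_mul (√T), abs_of_nonneg (Real.sqrt_nonneg T),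
    abs_of_pos hD2, abs_of_pos (by norm_num : (0 : ℝ) < 3 / 2)]
  calc _ ≤ 3 / 2 * D ^ 2 / (√T * D ^ 2) := by gcongr
    _ = _ := mul_div_mul_right _ _ hD2.ne'

/-- Chebyshev's inequality for a sum of independent centred copies of `Y`. -/
theorem measure_le_abs_sum_iid {Ω : Type*} [MeasurableSpace Ω] {P : Measure Ω}
    [IsProbabilityMeasure P] {n : ℕ} {W : Fin n → Ω → ℝ} {Y : Ω → ℝ} (hind : iIndepFun W P)
    (hident : ∀ i, IdentDistrib (W i) Y P P) (hY : MemLp Y 2 P) (hmean : ∫ ω, Y ω ∂P = 0)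
    {K : ℝ} (hK : 0 < K) :
    P {ω | K ≤ |∑ i, W i ω|} ≤ ENNReal.ofReal ((n * ∫ ω, Y ω ^ 2 ∂P) / K ^ 2) := by
  have hL2 : ∀ i, MemLp (W i) 2 P := fun i => (hident i).memLp_iff.mpr hY
  have hL2sum : MemLp (∑ i, W i) 2 P := memLp_finsetSum' _ fun i _ => hL2 i
  have hmeansum : ∫ ω, (∑ i, W i) ω ∂P = 0 := by
    simp only [Finset.sum_apply]
    rw [integral_finsetSum _ fun i _ => (hL2 i).integrable (by norm_num)]
    exact Finset.sum_eq_zero fun i _ => by rw [(hident i).integral_eq, hmean]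
  have hvar : variance (∑ i, W i) P = n * ∫ ω, Y ω ^ 2 ∂P := by
    have hvar0 : ∀ i, variance (W i) P = ∫ ω, Y ω ^ 2 ∂P := fun i => by
      rw [(hident i).variance_eq,
        variance_of_integral_eq_zero hY.aestronglyMeasurable.aemeasurable hmean]
    rw [IndepFun.variance_sum (fun i _ => hL2 i) fun i _ j _ hij => hind.indepFun hij,
      Finset.sum_congr rfl fun i _ => hvar0 i]
    simp
  have := meas_ge_le_variance_div_sq hL2sum hK
  rw [hmeansum, hvar] at this
  simpa using this

/-- The normalized error of the empirical second moment of `n` cells. -/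
noncomputable def normalizedError {Ω : Type*} (N : ℝ≥0 → Ω → ℕ) (lam D : ℝ) (n : ℕ) (ω : Ω) : ℝ :=
  ∑ i : Fin n, normalizedCell N lam D (n * D) i ω

namespace IsPoissonProcess

variable {Ω : Type*} [MeasurableSpace Ω] {P : Measure Ω} [IsProbabilityMeasure P]
  {N : ℝ≥0 → Ω → ℕ} {lam : ℝ≥0}

theorem aemeasurable_cellSq (h : IsPoissonProcess N lam P) {D : ℝ} (hD : 0 ≤ D) (i : ℕ) :
    AEMeasurable (cellSq N D i) P := (h.identDistrib_cellSq hD i).aemeasurable_fst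

theorem identDistrib_normalizedCell (h : IsPoissonProcess N lam P) {D : ℝ} (hD : 0 ≤ D) (T : ℝ)
    (i : ℕ) : IdentDistrib (normalizedCell N lam D T i) (normalizedCell N lam D T 0) P P :=
  (h.identDistrib_cellSq hD i).comp (u := fun y =>
    3 / 2 * (D ^ 2 * secondMomentRatio (lam * D) - y) / (√T * D ^ 2)) (by fun_prop)

theorem iIndepFun_normalizedCell (h : IsPoissonProcess N lam P) {D : ℝ} (hD : 0 ≤ D) (T : ℝ)
    (n : ℕ) : iIndepFun (fun i : Fin n => normalizedCell N lam D T i) P :=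
  (h.iIndepFun_cellSq hD n).comp (fun _ y =>
    3 / 2 * (D ^ 2 * secondMomentRatio (lam * D) - y) / (√T * D ^ 2)) fun _ => by fun_prop

theorem integrable_cellSq (h : IsPoissonProcess N lam P) {D : ℝ} (hD : 0 ≤ D) :
    Integrable (cellSq N D 0) P :=
  Integrable.of_bound (h.aemeasurable_cellSq hD 0).aestronglyMeasurable (D ^ 2)
    (Eventually.of_forall fun ω => by
      rw [Real.norm_of_nonneg (cellSq_nonneg N D 0 ω)]; exact cellSq_le N hD 0 ω)

theorem integrable_cellSq_sq (h : IsPoissonProcess N lam P) {D : ℝ} (hD : 0 ≤ D) :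
    Integrable (fun ω => cellSq N D 0 ω ^ 2) P :=
  Integrable.of_bound ((h.aemeasurable_cellSq hD 0).pow_const 2).aestronglyMeasurable ((D ^ 2) ^ 2)
    (Eventually.of_forall fun ω => by
      rw [Real.norm_of_nonneg (sq_nonneg _)]
      exact pow_le_pow_left₀ (cellSq_nonneg N D 0 ω) (cellSq_le N hD 0 ω) 2)

theorem integral_normalizedCell (h : IsPoissonProcess N lam P) (hlam : 0 < lam) {D : ℝ}
    (hD : 0 ≤ D) (T : ℝ) : ∫ ω, normalizedCell N lam D T 0 ω ∂P = 0 := by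
  simp only [normalizedCell]
  rw [integral_div, integral_const_mul, integral_sub (integrable_const _) (h.integrable_cellSq hD),
    h.integral_cellSq hlam hD]
  simp

theorem integral_normalizedCell_sq (h : IsPoissonProcess N lam P) (hlam : 0 < lam) {D : ℝ}
    (hD : 0 ≤ D) {T : ℝ} (hT : 0 ≤ T) : ∫ ω, normalizedCell N lam D T 0 ω ^ 2 ∂P
      = 9 / 4 * (fourthMoment lam D - (D ^ 2 * secondMomentRatio (lam * D)) ^ 2) / (T * D ^ 4) := by
  set m := D ^ 2 * secondMomentRatio (lam * D) with hm
  have hsq : ∀ ω, normalizedCell N lam D T 0 ω ^ 2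
      = 9 / 4 * (m ^ 2 - 2 * m * cellSq N D 0 ω + cellSq N D 0 ω ^ 2) / (T * D ^ 4) := by
    intro ω
    rw [normalizedCell, div_pow, mul_pow (√T), Real.sq_sqrt hT, ← pow_mul]
    ring
  simp_rw [hsq]
  have h1 := h.integrable_cellSq hD
  have h2 := h.integrable_cellSq_sq hD
  have h3 : Integrable (fun ω => m ^ 2 - 2 * m * cellSq N D 0 ω) P :=
    (integrable_const _).sub (h1.const_mul _)
  rw [integral_div, integral_const_mul, integral_add h3 h2,
    integral_sub (integrable_const _) (h1.const_mul _), integral_const_mul,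
    h.integral_cellSq hlam hD, h.integral_cellSq_sq hlam hD]
  simp only [integral_const, probReal_univ, smul_eq_mul, one_mul, ← hm]
  congr 1
  ring

variable {D : ℕ → ℝ}

/-- The factor `n` cancels against the horizon `n * D n`, leaving `9/4` times the cell variance over
`D n ^ 5`, and `(9/4) * (8/15) = 6/5`. -/
theorem tendsto_variance_normalizedCell (h : IsPoissonProcess N lam P) (hlam : 0 < lam)
    (hD : ∀ n, 0 < D n) (hD0 : Tendsto D atTop (𝓝 0)) :
    Tendsto (fun n : ℕ => n * ∫ ω, normalizedCell N lam (D n) (n * D n) 0 ω ^ 2 ∂P) atTop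
      (𝓝 ((6 / 5 * lam : ℝ≥0) : ℝ)) := by
  have hlim := (tendsto_fourthMoment_sub_div (lam := (lam : ℝ)) hlam hD hD0).const_mul (9 / 4)
  have hval : (9 / 4 : ℝ) * (8 / 15 * lam) = ((6 / 5 * lam : ℝ≥0) : ℝ) := by push_cast; ring
  rw [hval] at hlim
  refine hlim.congr' ?_
  filter_upwards [eventually_gt_atTop 0] with n hn
  have hDn := hD n
  rw [h.integral_normalizedCell_sq hlam hDn.le (by positivity)]
  have : (n : ℝ) ≠ 0 := by positivity
  field_simp

theorem tendstoInDistribution_normalizedError (h : IsPoissonProcess N lam P) (hlam : 0 < lam)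
    (hD : ∀ n, 0 < D n) (hD0 : Tendsto D atTop (𝓝 0))
    (hT : Tendsto (fun n : ℕ => n * D n) atTop atTop) :
    TendstoInDistribution (fun n ω => normalizedError N lam (D n) n ω) atTop (id : ℝ → ℝ)
      (fun _ => P) (gaussianReal 0 (6 / 5 * lam)) :=
  tendstoInDistribution_sum_iid_rows
    (W := fun n i => normalizedCell N lam (D n) (n * D n) i)
    (fun n => h.iIndepFun_normalizedCell (hD n).le _ n)
    (fun n i => h.identDistrib_normalizedCell (hD n).le _ i)
    (fun n => h.integral_normalizedCell hlam (hD n).le _)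
    (b := fun n : ℕ => 3 / 2 / √(n * D n))
    (fun n => Eventually.of_forall fun ω =>
      abs_normalizedCell_le N lam.coe_nonneg (hD n) _ 0 ω)
    ((Real.tendsto_sqrt_atTop.comp hT).const_div_atTop _)
    (h.tendsto_variance_normalizedCell hlam hD hD0)

theorem measure_le_abs_normalizedError (h : IsPoissonProcess N lam P) (hlam : 0 < lam) {D : ℝ}
    (hD : 0 < D) (n : ℕ) {K : ℝ} (hK : 0 < K) :
    P {ω | K ≤ |normalizedError N lam D n ω|} ≤ ENNReal.ofReal
      ((n * ∫ ω, normalizedCell N lam D (n * D) 0 ω ^ 2 ∂P) / K ^ 2) := by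
  have hind := h.iIndepFun_normalizedCell hD.le (n * D) n
  have hident := h.identDistrib_normalizedCell hD.le (n * D)
  have hmean := h.integral_normalizedCell hlam hD.le (n * D)
  have hbound : ∀ i ω, |normalizedCell N lam D (n * D) i ω| ≤ 3 / 2 / √(n * D) :=
    abs_normalizedCell_le N lam.coe_nonneg hD _
  simp only [normalizedError]
  generalize normalizedCell N lam D (n * D) = W at *
  exact measure_le_abs_sum_iid (W := fun i : Fin n => W i) hind (fun i => hident i)
    (MemLp.of_bound (hident 0).aemeasurable_fst.aestronglyMeasurable _
      (Eventually.of_forall fun ω => hbound 0 ω)) hmean hK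

/-- Chebyshev with convergent variances. Arbitrary diverging thresholds are allowed because the
solvability event, the linearization error and consistency each use a different one. -/
theorem tendsto_measure_le_abs_normalizedError (h : IsPoissonProcess N lam P) (hlam : 0 < lam)
    (hD : ∀ n, 0 < D n) (hD0 : Tendsto D atTop (𝓝 0)) {K : ℕ → ℝ} (hK : Tendsto K atTop atTop) :
    Tendsto (fun n => P {ω | K n ≤ |normalizedError N lam (D n) n ω|}) atTop (𝓝 0) := by
  have hlim := ENNReal.tendsto_ofReal ((h.tendsto_variance_normalizedCell hlam hD hD0).mul
    (tendsto_inv_atTop_zero.comp ((tendsto_pow_atTop (n := 2) two_ne_zero).comp hK)))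
  rw [mul_zero, ENNReal.ofReal_zero] at hlim
  refine tendsto_of_tendsto_of_tendsto_of_le_of_le' tendsto_const_nhds hlim
    (Eventually.of_forall fun _ => zero_le) ?_
  filter_upwards [hK.eventually_gt_atTop 0] with n hn
  exact h.measure_le_abs_normalizedError hlam (hD n) n hn

end IsPoissonProcess

/-! ### The telegraph process and its moment estimator -/

namespace IsTelegraphModel

variable {Ω : Type*} [MeasurableSpace Ω] {P : Measure Ω} {v : ℝ} {lam : ℝ≥0} {V₀ : Ω → ℝ}
  {N : ℝ≥0 → Ω → ℕ}

theorem velocity_sq (hX : IsTelegraphModel V₀ N v lam P) : ∀ᵐ ω ∂P, V₀ ω ^ 2 = v ^ 2 := by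
  have hp : MeasurableSet {x : ℝ | x ^ 2 = v ^ 2} :=
    measurableSet_eq_fun (measurable_id.pow_const 2) measurable_const
  rw [hX.law_velocity.ae_iff (p := fun x => x ^ 2 = v ^ 2) (measurableSet_setOfPred.1 hp),
    ae_add_measure_iff]
  constructor
  · exact Measure.ae_smul_measure ((ae_dirac_iff hp).2 rfl) _
  · exact Measure.ae_smul_measure ((ae_dirac_iff hp).2 (neg_sq v)) _

/-- Only `V₀ ^ 2 = v ^ 2` enters. The factor `2/3` undoes the `3/2` in `normalizedCell`, bringing
the empirical moment into the form needed by `moment_solution_bound`. -/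
theorem meanSqIncrement_eq (hX : IsTelegraphModel V₀ N v lam P) :
    ∀ᵐ ω ∂P, ∀ (D : ℝ) (n : ℕ), 0 < D → 0 < n →
      meanSqIncrement (fun t => telegraph V₀ N t ω) D n = v ^ 2 * D ^ 2
        * (secondMomentRatio (lam * D) - 2 / 3 * (D * (normalizedError N lam D n ω / √(n * D)))) := by
  filter_upwards [hX.velocity_sq, hX.poisson.path] with ω hv hω D n hD hn
  have hK : Monotone fun s : ℝ => N s.toNNReal ω :=
    fun s t hst => hω.1 (Real.toNNReal_mono hst)
  have hcell : ∀ i : ℕ, (telegraph V₀ N ((i + 1 : ℕ) * D) ω - telegraph V₀ N (i * D) ω) ^ 2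
      = v ^ 2 * cellSq N D i ω := by
    intro i
    rw [telegraph, telegraph, ← mul_sub, intervalIntegral.integral_interval_sub_left
      (intervalIntegrable_neg_one_pow hK _ _) (intervalIntegrable_neg_one_pow hK _ _), mul_pow, hv,
      cellSq]
  have hn' : (0 : ℝ) < n := by exact_mod_cast hn
  have hT : (0 : ℝ) < √(n * D) := Real.sqrt_pos.2 (by positivity)
  have hTT : √(n * D) ^ 2 = n * D := Real.sq_sqrt (by positivity)
  have herr : normalizedError N lam D n ω / √(n * D)
      = 3 / 2 * (n * (D ^ 2 * secondMomentRatio (lam * D))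
        - ∑ i ∈ Finset.range n, cellSq N D i ω) / (n * D * D ^ 2) := by
    rw [normalizedError, Fin.sum_univ_eq_sum_range fun i => normalizedCell N lam D (n * D) i ω]
    simp only [normalizedCell]
    rw [← Finset.sum_div, ← Finset.mul_sum, Finset.sum_sub_distrib, Finset.sum_const,
      Finset.card_range, nsmul_eq_mul, div_div]
    congr 1
    linear_combination D ^ 2 * hTT
  simp only [meanSqIncrement]
  rw [Finset.sum_congr rfl fun i _ => hcell i, ← Finset.mul_sum, herr]
  field_simp
  ring

end IsTelegraphModel

theorem ae_existsUnique_solvesMomentEquation_and_linearization {Ω : Type*} [MeasurableSpace Ω] {P : Measure Ω} [IsProbabilityMeasure P]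
    {v : ℝ} (hv : 0 < v) {lam0 : ℝ≥0} (hlam0 : 0 < lam0)
    {V₀ : Ω → ℝ} {N : ℝ≥0 → Ω → ℕ} (hX : IsTelegraphModel V₀ N v lam0 P)
    {D : ℝ} (hD : 0 < D) (hsmall : lam0 * D < 1 / 32) {n : ℕ} (hn : 0 < n) :
    ∀ᵐ ω ∂P, |normalizedError N lam0 D n ω| < 3 / 4 * lam0 * √(n * D) →
      (∃! l, SolvesMomentEquation v D n (fun t => telegraph V₀ N t ω) l) ∧
      ∀ l, SolvesMomentEquation v D n (fun t => telegraph V₀ N t ω) l →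
        |√(n * D) * (l - lam0) - normalizedError N lam0 D n ω|
          ≤ 16 * (lam0 * D) * |normalizedError N lam0 D n ω| := by
  filter_upwards [hX.meanSqIncrement_eq] with ω hω hZ
  have hn' : (0 : ℝ) < n := by exact_mod_cast hn
  have hT : (0 : ℝ) < √(n * D) := Real.sqrt_pos.2 (by positivity)
  have hR : |normalizedError N lam0 D n ω / √(n * D)| ≤ 3 / 4 * lam0 := by
    rw [abs_div, abs_of_pos hT, div_le_iff₀ hT]
    exact hZ.le
  obtain ⟨h0, h1, hl⟩ := moment_solution_bound hlam0 hD hsmall hR rfl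
  refine ⟨existsUnique_solvesMomentEquation hv hD (hω D n hD hn) h0 h1, fun l hsol => ?_⟩
  have hsol' := (solvesMomentEquation_iff hv hD (hω D n hD hn) l).1 hsol
  have := mul_le_mul_of_nonneg_left (hl l hsol'.1 hsol'.2) hT.le
  have e1 : √(n * D) * (l - lam0) - normalizedError N lam0 D n ω
      = √(n * D) * (l - lam0 - normalizedError N lam0 D n ω / √(n * D)) := by
    field_simp
  rw [e1, abs_mul, abs_of_pos hT]
  refine this.trans (le_of_eq ?_)
  rw [abs_div, abs_of_pos hT, mul_left_comm, mul_div_cancel₀ _ hT.ne']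
  rfl

theorem tendsto_measure_one_of_compl {Ω : Type*} [MeasurableSpace Ω] {P : Measure Ω}
    [IsProbabilityMeasure P] {A B : ℕ → Set Ω} (hB : Tendsto (fun n => P (B n)) atTop (𝓝 0))
    (hAB : ∀ᶠ n in atTop, ∀ᵐ ω ∂P, ω ∉ B n → ω ∈ A n) :
    Tendsto (fun n => P (A n)) atTop (𝓝 1) := by
  have hlim : Tendsto (fun n => 1 - P (B n)) atTop (𝓝 1) := by
    simpa using ENNReal.Tendsto.sub tendsto_const_nhds hB (Or.inl ENNReal.one_ne_top)
  refine tendsto_of_tendsto_of_tendsto_of_le_of_le' hlim tendsto_const_nhds ?_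
    (Eventually.of_forall fun _ => prob_le_one)
  filter_upwards [hAB] with n hn
  rw [tsub_le_iff_right, ← measure_univ (μ := P)]
  refine (measure_mono_ae ?_).trans (measure_union_le _ _)
  filter_upwards [hn] with ω hω _
  by_cases h : ω ∈ B n
  · exact Or.inr h
  · exact Or.inl (hω h)

theorem tendsto_measure_zero_of_subset_union {Ω : Type*} [MeasurableSpace Ω] {P : Measure Ω}
    {A B C : ℕ → Set Ω} (hB : Tendsto (fun n => P (B n)) atTop (𝓝 0))
    (hC : Tendsto (fun n => P (C n)) atTop (𝓝 0))
    (hABC : ∀ᶠ n in atTop, ∀ᵐ ω ∂P, ω ∈ A n → ω ∈ B n ∨ ω ∈ C n) :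
    Tendsto (fun n => P (A n)) atTop (𝓝 0) := by
  have hlim := hB.add hC
  rw [add_zero] at hlim
  refine tendsto_of_tendsto_of_tendsto_of_le_of_le' tendsto_const_nhds hlim
    (Eventually.of_forall fun _ => zero_le) ?_
  filter_upwards [hABC] with n hn
  exact (measure_mono_ae hn).trans (measure_union_le _ _)

theorem theorem1 {Ω : Type*} [MeasurableSpace Ω] (P : Measure Ω) [IsProbabilityMeasure P]
    (v : ℝ) (hv : 0 < v) (lam0 : ℝ≥0) (hlam0 : 0 < lam0)
    (V₀ : Ω → ℝ) (N : ℝ≥0 → Ω → ℕ) (hX : IsTelegraphModel V₀ N v lam0 P)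
    (Δ : ℕ → ℝ) (hΔpos : ∀ n, 0 < Δ n) (hΔ : Tendsto Δ atTop (𝓝 0))
    (hT : Tendsto (fun n : ℕ => n * Δ n) atTop atTop)
    (est : ℕ → Ω → ℝ) (hest : IsMomentEstimator P v Δ (telegraph V₀ N) est) :
    -- the moment equation has exactly one solution with probability tending to one
    Tendsto (fun n : ℕ => P {ω | ∃! l, SolvesMomentEquation v (Δ n) n
      (fun t => telegraph V₀ N t ω) l}) atTop (𝓝 1) ∧
    -- consistency
    TendstoInMeasure P est atTop (fun _ => (lam0 : ℝ)) ∧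
    -- asymptotic normality
    IsAsymptoticallyNormal P (fun n : ℕ => n * Δ n) est lam0 (6 / 5 * lam0) ∧
    -- the minimal asymptotic variance is attained by `N(T) / T` and is strictly smaller,
    -- so that `est` is not efficient
    IsAsymptoticallyEfficient P (fun n : ℕ => n * Δ n)
      (fun n ω => (N (n * Δ n).toNNReal ω : ℝ) / (n * Δ n)) lam0 ∧
    (poissonFisherInformation lam0)⁻¹ = lam0 ∧ (lam0 : ℝ) < 6 / 5 * lam0 ∧
    ¬ IsAsymptoticallyEfficient P (fun n : ℕ => n * Δ n) est lam0 := by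
  have hlam : (0 : ℝ) < lam0 := hlam0
  have hN := hX.poisson
  have hsqrt : Tendsto (fun n : ℕ => √(n * Δ n)) atTop atTop := Real.tendsto_sqrt_atTop.comp hT
  have hLΔ : Tendsto (fun n => lam0 * Δ n) atTop (𝓝 0) := by
    simpa using hΔ.const_mul (lam0 : ℝ)
  -- outside this event the moment equation is uniquely solvable and can be linearized
  let bad : ℕ → Set Ω := fun n =>
    {ω | 3 / 4 * lam0 * √(n * Δ n) ≤ |normalizedError N lam0 (Δ n) n ω|}
  have hbad : Tendsto (fun n => P (bad n)) atTop (𝓝 0) :=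
    hN.tendsto_measure_le_abs_normalizedError hlam0 hΔpos hΔ
      (hsqrt.const_mul_atTop (by positivity))
  have hgood : ∀ᶠ n in atTop, ∀ᵐ ω ∂P, ω ∉ bad n →
      (∃! l, SolvesMomentEquation v (Δ n) n (fun t => telegraph V₀ N t ω) l) ∧
      |√(n * Δ n) * (est n ω - lam0) - normalizedError N lam0 (Δ n) n ω|
        ≤ 16 * (lam0 * Δ n) * |normalizedError N lam0 (Δ n) n ω| := by
    filter_upwards [eventually_gt_atTop 0,
      hLΔ.eventually_lt_const (by norm_num : (0 : ℝ) < 1 / 32)] with n hn hs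
    filter_upwards [ae_existsUnique_solvesMomentEquation_and_linearization hv hlam0 hX (hΔpos n) hs hn, hest.solves n] with ω h1 h2 hb
    obtain ⟨h3, h4⟩ := h1 (not_le.1 hb)
    exact ⟨h3, h4 _ (h2 h3.exists)⟩
  have hnormal : IsAsymptoticallyNormal P (fun n : ℕ => n * Δ n) est lam0 (6 / 5 * lam0) := by
    refine tendstoInDistribution_of_tendstoInMeasure_sub _ _
      (hN.tendstoInDistribution_normalizedError hlam0 hΔpos hΔ hT) ?_
      fun n => ((hest.aemeasurable n).sub_const _).const_mul _
    rw [tendstoInMeasure_iff_norm]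
    intro ε hε
    -- Outside `bad n`, a linearization error of at least `ε` forces the normalized error above this
    -- diverging threshold.
    have hK : Tendsto (fun n => ε / (16 * (lam0 * Δ n))) atTop atTop := by
      have h16 : Tendsto (fun n => 16 * (lam0 * Δ n)) atTop (𝓝[>] 0) := by
        refine tendsto_nhdsWithin_iff.2 ⟨by simpa using hLΔ.const_mul 16,
          Eventually.of_forall fun n => ?_⟩
        have := hΔpos n
        exact mem_Ioi.2 (by positivity)
      simpa [div_eq_mul_inv] using (tendsto_inv_nhdsGT_zero.comp h16).const_mul_atTop hε
    refine tendsto_measure_zero_of_subset_union hbad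
      (hN.tendsto_measure_le_abs_normalizedError hlam0 hΔpos hΔ hK) ?_
    filter_upwards [hgood] with n hn
    filter_upwards [hn] with ω hω hA
    by_cases hb : ω ∈ bad n
    · exact Or.inl hb
    · have hpos := hΔpos n
      refine Or.inr ?_
      simp only [Pi.sub_apply, Pi.zero_apply, sub_zero, Real.norm_eq_abs] at hA ⊢
      rw [div_le_iff₀ (by positivity), mul_comm]
      exact hA.trans (hω hb).2
  have hfisher : (poissonFisherInformation lam0)⁻¹ = lam0 := by
    rw [poissonFisherInformation_eq hlam0, inv_inv]
  refine ⟨tendsto_measure_one_of_compl hbad ?_, ?_, hnormal, ?_, hfisher, by linarith, ?_⟩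
  · filter_upwards [hgood] with n hn
    filter_upwards [hn] with ω hω hb using (hω hb).1
  · rw [tendstoInMeasure_iff_norm]
    intro ε hε
    -- Since `16 * lam0 * Δ n < 1` eventually, the scaled estimation error is at most twice the
    -- normalized error outside `bad n`; hence the threshold `ε / 2` times `√(n * Δ n)`.
    refine tendsto_measure_zero_of_subset_union hbad
      (hN.tendsto_measure_le_abs_normalizedError hlam0 hΔpos hΔ
        (hsqrt.const_mul_atTop (by positivity : 0 < ε / 2))) ?_
    filter_upwards [hgood, hLΔ.eventually_lt_const (by norm_num : (0 : ℝ) < 1 / 32)] with n hn hs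
    filter_upwards [hn] with ω hω hA
    by_cases hb : ω ∈ bad n
    · exact Or.inl hb
    · refine Or.inr ?_
      simp only [Real.norm_eq_abs] at hA ⊢
      have h1 := (hω hb).2
      set Z := normalizedError N lam0 (Δ n) n ω
      have h2 : |√(n * Δ n) * (est n ω - lam0)|
          ≤ |√(n * Δ n) * (est n ω - lam0) - Z| + |Z| := by
        simpa using abs_add_le (√(n * Δ n) * (est n ω - lam0) - Z) Z
      rw [abs_mul, abs_of_nonneg (Real.sqrt_nonneg _)] at h2
      have h3 := mul_le_mul_of_nonneg_left hA (Real.sqrt_nonneg (n * Δ n))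
      have h4 : 16 * (lam0 * Δ n) * |Z| ≤ 1 * |Z| := by
        gcongr; linarith
      linarith
  · rw [IsAsymptoticallyEfficient, hfisher, Real.toNNReal_coe]
    refine tendstoInDistribution_poisson (hT.eventually_gt_atTop 0) hT fun n => ?_
    refine (by simpa using hN.law_increment 0 (n * Δ n).toNNReal zero_le :
      HasLaw (fun ω => N (n * Δ n).toNNReal ω - N 0 ω)
        (poissonMeasure (lam0 * (n * Δ n).toNNReal)) P).congr ?_
    filter_upwards [hN.zero] with ω hω
    rw [hω, Nat.sub_zero]
  · intro heff
    rw [IsAsymptoticallyEfficient, hfisher, Real.toNNReal_coe] at heff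
    -- Efficiency would give the same sequence two Gaussian limits, forcing `(6/5) lam0 = lam0`.
    have := tendstoInDistribution_unique _ hnormal heff
    rw [Measure.map_id, Measure.map_id, gaussianReal_ext_iff] at this
    have h2 : ((6 / 5 * lam0 : ℝ≥0) : ℝ) = lam0 := congrArg _ this.2
    push_cast at h2
    linarith
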